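/- **Setting.** Let $G=\mathrm{SU}(1,1)$, identified with $\{(z,w)\in\mathbb C^2: |z|^2-|w|^2=-1\}$ by letting $(z,w)$ stand for the matrix with rows $(\bar w,z)$ and $(\bar z,w)$; it acts on the unit disc $\mathbb D$ by $(z,w)\cdot x=(\bar w x+z)/(\bar z x+w)$. Let $\langle (z_1,w_1),(z_2,w_2)\rangle=\mathrm{Re}(z_1\bar z_2-w_1\bar w_2)$ on $\mathbb C^2$ and $L=\{(z,w)\in\mathbb C^2:|z|<|w|\}\supset G$. Let $\pi:\tilde L\to L$ be the universal covering, $\tilde L=\{(z,\alpha,r)\in\mathbb C\times\mathbb R\times\mathbb R: |z|<r\}$, $\pi(z,\alpha,r)=(z,re^{i\alpha})$, and let $\tilde G=\pi^{-1}(G)\subset\tilde L$, the universal covering group $\widetilde{\mathrm{SU}}(1,1)$ of $G$ (with unit element $(0,0,1)$), with centre $Z\cong\mathbb Z$, so that $\tilde G/Z=\mathrm{PSU}(1,1)$. The group $\tilde G$ acts on $\mathbb D$ through $G$. The level of a discrete subgroup $\Gamma\subset\tilde G$ is the index of $\Gamma\cap Z$ in $Z$. Let $\Gamma_1\subset\tilde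 G$ be a discrete subgroup and $\Gamma_2\subset\tilde G$ a discrete cyclic subgroup, both of the same finite level $k$, with images $\overline\Gamma_1,\overline\Gamma_2$ in $\mathrm{PSU}(1,1)$. Let $u\in\mathbb D$ be a point that is fixed by a non-trivial element of $\overline\Gamma_1$ and by a non-trivial element of $\overline\Gamma_2$, let $p_i$ be the order of the isotropy group $(\overline\Gamma_i)_u$, and assume that $\mathrm{lcm}(p_1,p_2)>k$. The group $\Gamma=\Gamma_1\times\Gamma_2$ acts on $\tilde G$ by $(g,h)\cdot x=gxh^{-1}$. For $g\in\tilde G$ let $I_g$ be the connected component containing $g$ of $\{q\in\tilde L:\langle\pi(g),\pi(q)\rangle\le-1\}$, and let $H_g$ be the closure of $\tilde L\setminus I_g$; $I_g$ and $H_g$ are the two half-spaces of $\tilde L$ bounded by their common boundary $E_g$. For $x$ in the orbit $\Gamma_1(u)$ let $Q_x=\bigcap H_{g_1g_2}$, the intersection over all $(g_1,g_2)\in\Gamma_1\times\Gamma_2$ with $g_1(u)=x$. Let $P=\bigcup_{x\in\Gamma_1(u)}Q_x$, and for $g\in\tilde G$ let $F_g$ be the closure of the interior of $\partial H_g\cap\partial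 P$, closure and interior being taken in $\partial P$. **Theorem B.** If $\Gamma$ is co-compact, i.e. the orbit space of the action of $\Gamma_1\times\Gamma_2$ on $\tilde G$ is compact, then for every $g=g_1g_2$ with $g_1\in\Gamma_1$ and $g_2\in\Gamma_2$ the set $F_g$ is compact. Moreover $F_g$ is a compact polyhedron, that is, a finite union of compact sets each of which is the intersection of finitely many half-spaces, where a half-space is one of the sets $I_a$, $H_a$ with $a\in\tilde G$. -/

import Mathlib

open Set Topology ComplexConjugate

noncomputable section

/-- The universal cover `G̃` of `G = SU(1,1) = {(z, w) ∈ ℂ² : |z|² - |w|² = -1}`.  A point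
`(z, α)` of `ℂ × ℝ` lies over `(z, r exp (iα)) ∈ G` with `r = √(1 + |z|²)`; the pair `(z, w) ∈ G`
stands for the matrix with rows `(conj w, z)` and `(conj z, w)`. -/
@[ext] structure SUTilde where
  z : ℂ
  arg : ℝ

/-- The universal cover `L̃` of the cone `L = {(z, w) ∈ ℂ² : |z| < |w|}`: a point `(z, α, r)`
with `|z| < r` lies over `(z, r exp (iα))`. -/
@[ext] structure LTilde where
  z : ℂ
  arg : ℝ
  r : ℝ
  norm_lt : ‖z‖ < r

namespace SUTilde

instance : TopologicalSpace SUTilde :=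
  TopologicalSpace.induced (fun g : SUTilde => (g.z, g.arg)) inferInstance

/-- The third coordinate `r = √(1 + |z|²)` of a point of `G̃`. -/
def r (g : SUTilde) : ℝ := Real.sqrt (1 + ‖g.z‖ ^ 2)

/-- The second coordinate `w = r exp (iα)` of the image in `G` of a point of `G̃`. -/
def w (g : SUTilde) : ℂ := g.r * Complex.exp (g.arg * Complex.I)

theorem r_pos (g : SUTilde) : 0 < g.r := Real.sqrt_pos.2 (by positivity)

theorem norm_w (g : SUTilde) : ‖g.w‖ = g.r := by
  rw [w, norm_mul, Complex.norm_exp_ofReal_mul_I, mul_one, Complex.norm_real, Real.norm_eq_abs,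
    abs_of_pos g.r_pos]

theorem r_sq (g : SUTilde) : g.r ^ 2 = 1 + ‖g.z‖ ^ 2 := Real.sq_sqrt (by positivity)

theorem norm_z_lt_r (g : SUTilde) : ‖g.z‖ < g.r := by
  have h1 := g.r_sq
  have h2 := g.r_pos
  nlinarith [norm_nonneg g.z]

theorem w_ne_zero (g : SUTilde) : g.w ≠ 0 := by
  rw [← norm_pos_iff, norm_w]; exact g.r_pos

theorem w_mul_conj (g : SUTilde) : g.w * conj g.w = 1 + g.z * conj g.z := by
  rw [Complex.mul_conj, Complex.mul_conj, Complex.normSq_eq_norm_sq, Complex.normSq_eq_norm_sq,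
    norm_w, r_sq]
  push_cast; rfl

/-- The multiplication of `G̃`: the lift of matrix multiplication
`(z, w) (z', w') = (conj w z' + z w', conj z z' + w w')` with unit element `(0, 0)`.  As
`|conj z z' / (w w')| < 1`, the principal argument depends continuously on both factors. -/
instance : Mul SUTilde where
  mul g h := ⟨conj g.w * h.z + g.z * h.w,
    g.arg + h.arg + Complex.arg (1 + conj g.z * h.z / (g.w * h.w))⟩

instance : One SUTilde := ⟨⟨0, 0⟩⟩

instance : Inv SUTilde := ⟨fun g => ⟨-g.z, -g.arg⟩⟩

theorem mul_z (g h : SUTilde) : (g * h).z = conj g.w * h.z + g.z * h.w := rfl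

theorem mul_arg (g h : SUTilde) :
    (g * h).arg = g.arg + h.arg + Complex.arg (1 + conj g.z * h.z / (g.w * h.w)) := rfl

theorem norm_quot_lt (g h : SUTilde) : ‖conj g.z * h.z / (g.w * h.w)‖ < 1 := by
  rw [norm_div, norm_mul, norm_mul, Complex.norm_conj, norm_w, norm_w,
    div_lt_one (mul_pos g.r_pos h.r_pos)]
  exact mul_lt_mul'' g.norm_z_lt_r h.norm_z_lt_r (norm_nonneg _) (norm_nonneg _)

theorem re_pos (g h : SUTilde) : 0 < (1 + conj g.z * h.z / (g.w * h.w)).re := by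
  have h1 := Complex.abs_re_le_norm (conj g.z * h.z / (g.w * h.w))
  have h2 := norm_quot_lt g h
  have h3 := neg_abs_le (conj g.z * h.z / (g.w * h.w)).re
  rw [Complex.add_re, Complex.one_re]
  linarith

theorem abs_arg_lt (g h : SUTilde) :
    |Complex.arg (1 + conj g.z * h.z / (g.w * h.w))| < Real.pi / 2 :=
  Complex.abs_arg_lt_pi_div_two_iff.2 (Or.inl (re_pos g h))

theorem mul_w (g h : SUTilde) : (g * h).w = conj g.z * h.z + g.w * h.w := by
  have hne : g.w * h.w ≠ 0 := mul_ne_zero g.w_ne_zero h.w_ne_zero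
  have hfac : conj g.z * h.z + g.w * h.w
      = g.w * h.w * (1 + conj g.z * h.z / (g.w * h.w)) := by
    rw [mul_add, mul_one, mul_div_cancel₀ _ hne]; ring
  have hr : ((g * h).r : ℝ) = ‖conj g.z * h.z + g.w * h.w‖ := by
    rw [r, mul_z]
    rw [Real.sqrt_eq_iff_mul_self_eq (by positivity) (norm_nonneg _), ← sq]
    have key : ((‖conj g.z * h.z + g.w * h.w‖ ^ 2 : ℝ) : ℂ)
        = ((1 + ‖conj g.w * h.z + g.z * h.w‖ ^ 2 : ℝ) : ℂ) := by
      push_cast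
      rw [← Complex.mul_conj', ← Complex.mul_conj']
      simp only [map_add, map_mul, Complex.conj_conj]
      have e1 := g.w_mul_conj
      have e2 := h.w_mul_conj
      linear_combination (h.w * conj h.w - h.z * conj h.z) * e1 + e2
    exact_mod_cast key.symm
  rw [w, hr, mul_arg, hfac, norm_mul, norm_mul, norm_w, norm_w]
  push_cast
  rw [add_mul, add_mul, Complex.exp_add, Complex.exp_add]
  conv_rhs => rw [← Complex.norm_mul_exp_arg_mul_I (1 + conj g.z * h.z / (g.w * h.w))]
  rw [w, w]
  ring

theorem eq_of_abs_lt {g h : SUTilde} (hz : g.z = h.z) (hw : g.w = h.w)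
    (ha : |g.arg - h.arg| < 2 * Real.pi) : g = h := by
  have hr : g.r = h.r := by rw [← norm_w, ← norm_w, hw]
  rw [w, w, hr] at hw
  have h0 : (h.r : ℂ) ≠ 0 := by exact_mod_cast h.r_pos.ne'
  obtain ⟨n, hn⟩ := Complex.exp_eq_exp_iff_exists_int.1 (mul_left_cancel₀ h0 hw)
  have hn' : g.arg - h.arg = n * (2 * Real.pi) := by
    have h2 := congrArg Complex.im hn
    simp at h2
    linarith
  rw [hn', abs_mul, abs_of_pos Real.two_pi_pos] at ha
  have h3 : |(n : ℝ)| < 1 := by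
    by_contra hcon
    nlinarith [Real.two_pi_pos, not_lt.1 hcon]
  have h4 : n = 0 := Int.abs_lt_one_iff.1 (by exact_mod_cast h3)
  subst h4
  ext1
  · exact hz
  · simpa [sub_eq_zero] using hn'

theorem one_w : (1 : SUTilde).w = 1 := by
  change ((Real.sqrt (1 + ‖(0 : ℂ)‖ ^ 2) : ℝ) : ℂ) * Complex.exp (((0 : ℝ) : ℂ) * Complex.I) = 1
  simp

theorem one_z : (1 : SUTilde).z = 0 := rfl

theorem one_arg : (1 : SUTilde).arg = 0 := rfl

theorem inv_w (g : SUTilde) : (g⁻¹).w = conj g.w := by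
  change ((Real.sqrt (1 + ‖-g.z‖ ^ 2) : ℝ) : ℂ) * Complex.exp (((-g.arg : ℝ) : ℂ) * Complex.I) = _
  rw [norm_neg, w, map_mul, Complex.conj_ofReal, ← Complex.exp_conj, map_mul, Complex.conj_ofReal,
    Complex.conj_I, r]
  push_cast
  rw [neg_mul, mul_neg]

theorem inv_z (g : SUTilde) : (g⁻¹).z = -g.z := rfl

theorem inv_arg (g : SUTilde) : (g⁻¹).arg = -g.arg := rfl

instance : Group SUTilde :=
  Group.ofLeftAxioms
    (by
      intro a b c
      apply eq_of_abs_lt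
      · simp only [mul_z, mul_w, map_add, map_mul, Complex.conj_conj]; ring
      · simp only [mul_z, mul_w, map_add, map_mul, Complex.conj_conj]; ring
      · rw [mul_arg (a * b) c, mul_arg a b, mul_arg a (b * c), mul_arg b c]
        have h1 := abs_lt.1 (abs_arg_lt (a * b) c)
        have h2 := abs_lt.1 (abs_arg_lt a b)
        have h3 := abs_lt.1 (abs_arg_lt a (b * c))
        have h4 := abs_lt.1 (abs_arg_lt b c)
        rw [abs_lt]
        constructor <;> linarith [h1.1, h1.2, h2.1, h2.2, h3.1, h3.2, h4.1, h4.2])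
    (by
      intro a
      ext1
      · rw [mul_z, one_w, one_z]; simp
      · rw [mul_arg, one_arg, one_z]; simp)
    (by
      intro a
      ext1
      · rw [mul_z, inv_w, inv_z, one_z, Complex.conj_conj]; ring
      · rw [mul_arg, inv_w, inv_z, inv_arg, one_arg]
        have h : conj (-a.z) * a.z / (conj a.w * a.w) = ((-(‖a.z‖ ^ 2 / a.r ^ 2) : ℝ) : ℂ) := by
          rw [map_neg, neg_mul, Complex.conj_mul', Complex.conj_mul', norm_w]
          push_cast; ring
        have h0 : (0 : ℝ) ≤ 1 + -(‖a.z‖ ^ 2 / a.r ^ 2) := by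
          have h1 : ‖a.z‖ ^ 2 / a.r ^ 2 ≤ 1 := by
            rw [div_le_one (by have := a.r_pos; positivity), r_sq]; linarith
          linarith
        rw [h, ← Complex.ofReal_one, ← Complex.ofReal_add, Complex.arg_ofReal_of_nonneg h0]
        ring)

theorem disc_den_ne_zero (g : SUTilde) (x : Complex.UnitDisc) : conj g.z * (x : ℂ) + g.w ≠ 0 := by
  intro h
  have h1 : g.w = -(conj g.z * (x : ℂ)) := by linear_combination h
  have h2 : g.r = ‖g.z‖ * ‖(x : ℂ)‖ := by
    rw [← norm_w, h1, norm_neg, norm_mul, Complex.norm_conj]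
  nlinarith [g.norm_z_lt_r, x.norm_lt_one, norm_nonneg g.z, norm_nonneg (x : ℂ)]

theorem norm_disc_lt_one (g : SUTilde) (x : Complex.UnitDisc) :
    ‖(conj g.w * (x : ℂ) + g.z) / (conj g.z * (x : ℂ) + g.w)‖ < 1 := by
  have hpos : 0 < ‖conj g.z * (x : ℂ) + g.w‖ := norm_pos_iff.2 (disc_den_ne_zero g x)
  rw [norm_div, div_lt_one hpos]
  have key : ((‖conj g.z * (x : ℂ) + g.w‖ ^ 2 - ‖conj g.w * (x : ℂ) + g.z‖ ^ 2 : ℝ) : ℂ)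
      = ((1 - ‖(x : ℂ)‖ ^ 2 : ℝ) : ℂ) := by
    push_cast
    rw [← Complex.mul_conj', ← Complex.mul_conj', ← Complex.mul_conj']
    simp only [map_add, map_mul, Complex.conj_conj]
    linear_combination (1 - (x : ℂ) * conj (x : ℂ)) * g.w_mul_conj
  have key' : ‖conj g.z * (x : ℂ) + g.w‖ ^ 2 - ‖conj g.w * (x : ℂ) + g.z‖ ^ 2
      = 1 - ‖(x : ℂ)‖ ^ 2 := by exact_mod_cast key
  have hx := x.sq_norm_lt_one
  exact lt_of_pow_lt_pow_left₀ 2 hpos.le (by linarith)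

/-- The action of `G̃` on the unit disc by orientation-preserving isometries (Möbius
transformations).  Its kernel is the centre of `G̃`. -/
instance : MulAction SUTilde Complex.UnitDisc where
  smul g x := Complex.UnitDisc.mk
    ((conj g.w * (x : ℂ) + g.z) / (conj g.z * (x : ℂ) + g.w)) (norm_disc_lt_one g x)
  one_smul x := by
    apply Complex.UnitDisc.coe_injective
    change (conj (1 : SUTilde).w * (x : ℂ) + (1 : SUTilde).z) /
      (conj (1 : SUTilde).z * (x : ℂ) + (1 : SUTilde).w) = x
    rw [one_w, one_z]; simp
  mul_smul g h x := by
    apply Complex.UnitDisc.coe_injective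
    change (conj (g * h).w * (x : ℂ) + (g * h).z) / (conj (g * h).z * (x : ℂ) + (g * h).w) =
      (conj g.w * ((conj h.w * (x : ℂ) + h.z) / (conj h.z * (x : ℂ) + h.w)) + g.z) /
      (conj g.z * ((conj h.w * (x : ℂ) + h.z) / (conj h.z * (x : ℂ) + h.w)) + g.w)
    have h1 := disc_den_ne_zero h x
    have h2 : (conj g.w * ((conj h.w * (x : ℂ) + h.z) / (conj h.z * (x : ℂ) + h.w)) + g.z)
        = (conj (g * h).w * (x : ℂ) + (g * h).z) / (conj h.z * (x : ℂ) + h.w) := by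
      rw [mul_w, mul_z, eq_div_iff h1, add_mul, mul_assoc, div_mul_cancel₀ _ h1]
      simp only [map_add, map_mul, Complex.conj_conj]; ring
    have h3 : (conj g.z * ((conj h.w * (x : ℂ) + h.z) / (conj h.z * (x : ℂ) + h.w)) + g.w)
        = (conj (g * h).z * (x : ℂ) + (g * h).w) / (conj h.z * (x : ℂ) + h.w) := by
      rw [mul_w, mul_z, eq_div_iff h1, add_mul, mul_assoc, div_mul_cancel₀ _ h1]
      simp only [map_add, map_mul, Complex.conj_conj]; ring
    rw [h2, h3, div_div_div_cancel_right₀ h1]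

/-- The embedding of `G̃` in `L̃`. -/
def toL (g : SUTilde) : LTilde := ⟨g.z, g.arg, g.r, g.norm_z_lt_r⟩

end SUTilde

namespace LTilde

instance : TopologicalSpace LTilde :=
  TopologicalSpace.induced (fun q : LTilde => (q.z, q.arg, q.r)) inferInstance

/-- The covering map `π : L̃ → L ⊆ ℂ²`. -/
def proj (q : LTilde) : ℂ × ℂ := (q.z, q.r * Complex.exp (q.arg * Complex.I))

end LTilde

/-- The bilinear form of signature `(2,2)` on `ℂ²`. -/
def form22 (a b : ℂ × ℂ) : ℝ := (a.1 * conj b.1 - a.2 * conj b.2).re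

/-- The half-space `I_g`: the connected component containing `g` of the preimage in `L̃` of
`{a ∈ L : ⟨π g, a⟩ ≤ -1}`. -/
def halfI (g : SUTilde) : Set LTilde :=
  connectedComponentIn {q : LTilde | form22 g.toL.proj q.proj ≤ -1} g.toL

/-- The complementary closed half-space `H_g`: the closure of the complement of `I_g`.  The common
boundary of `I_g` and `H_g` is the hypersurface `E_g`. -/
def halfH (g : SUTilde) : Set LTilde := closure (halfI g)ᶜ

/-- `T(x)`: the pairs `(g₁, g₂) ∈ Γ₁ × Γ₂` with `g₁ u = x`. -/
def setT (Γ₁ Γ₂ : Subgroup SUTilde) (u x : Complex.UnitDisc) : Set (SUTilde × SUTilde) :=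
  {g | g.1 ∈ Γ₁ ∧ g.2 ∈ Γ₂ ∧ g.1 • u = x}

/-- The prism `Q_x`: the intersection of the `H_{g₁ g₂}` over `(g₁, g₂) ∈ T(x)`. -/
def prismQ (Γ₁ Γ₂ : Subgroup SUTilde) (u x : Complex.UnitDisc) : Set LTilde :=
  ⋂ g ∈ setT Γ₁ Γ₂ u x, halfH (g.1 * g.2)

/-- `P`: the union of the prisms `Q_x` over the orbit of `u` under `Γ₁`. -/
def polyP (Γ₁ Γ₂ : Subgroup SUTilde) (u : Complex.UnitDisc) : Set LTilde :=
  ⋃ x ∈ MulAction.orbit Γ₁ u, prismQ Γ₁ Γ₂ u x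

/-- `F_g`: the closure of the interior of `∂H_g ∩ ∂P`, where interior and closure are taken in
the space `∂P`. -/
def domF (Γ₁ Γ₂ : Subgroup SUTilde) (u : Complex.UnitDisc) (g : SUTilde) : Set LTilde :=
  Subtype.val '' closure (interior
    {q : frontier (polyP Γ₁ Γ₂ u) | (q : LTilde) ∈ frontier (halfH g)})

/-- The order of the isotropy group of `u` in the image of `Γ` in `PSU(1,1)`, the quotient of `G̃`
by its centre. -/
def isotropyOrder (Γ : Subgroup SUTilde) (u : Complex.UnitDisc) : ℕ :=
  Nat.card ((Γ ⊓ MulAction.stabilizer SUTilde u).map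
    (QuotientGroup.mk' (Subgroup.center SUTilde)))

/-- The standing assumptions: `Γ₁` is a discrete subgroup and `Γ₂` a discrete cyclic subgroup
of `G̃`, both of finite level `k` (the index of `Γ ∩ Z` in the centre `Z`); the point `u` is fixed
by an element of `Γ₁` and by an element of `Γ₂` with non-trivial images in `PSU(1,1)`, and the
least common multiple of the orders of the two isotropy groups of `u` exceeds `k`. -/
structure Admissible (Γ₁ Γ₂ : Subgroup SUTilde) (k : ℕ) (u : Complex.UnitDisc) : Prop where
  discrete₁ : DiscreteTopology Γ₁
  discrete₂ : DiscreteTopology Γ₂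
  cyclic₂ : IsCyclic Γ₂
  level_pos : 0 < k
  level₁ : Γ₁.relIndex (Subgroup.center SUTilde) = k
  level₂ : Γ₂.relIndex (Subgroup.center SUTilde) = k
  fixed₁ : ∃ g ∈ Γ₁, g ∉ Subgroup.center SUTilde ∧ g • u = u
  fixed₂ : ∃ g ∈ Γ₂, g ∉ Subgroup.center SUTilde ∧ g • u = u
  level_lt : k < Nat.lcm (isotropyOrder Γ₁ u) (isotropyOrder Γ₂ u)

/-- The action of `Γ₁ × Γ₂` on `G̃` by `(g, h) • x = g x h⁻¹`. -/
@[reducible] def biAction (Γ₁ Γ₂ : Subgroup SUTilde) : MulAction (Γ₁ × Γ₂) SUTilde where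
  smul γ x := γ.1 * x * (γ.2 : SUTilde)⁻¹
  one_smul x := by
    change ((1 : Γ₁) : SUTilde) * x * ((1 : Γ₂) : SUTilde)⁻¹ = x
    simp
  mul_smul γ δ x := by
    change ((γ.1 * δ.1 : Γ₁) : SUTilde) * x * ((γ.2 * δ.2 : Γ₂) : SUTilde)⁻¹ =
      γ.1 * (δ.1 * x * (δ.2 : SUTilde)⁻¹) * (γ.2 : SUTilde)⁻¹
    simp [mul_assoc]

/-- `Γ₁ × Γ₂` is co-compact: the orbit space of its action on `G̃` is compact. -/
def IsCocompact (Γ₁ Γ₂ : Subgroup SUTilde) : Prop :=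
  CompactSpace (Quotient (@MulAction.orbitRel (Γ₁ × Γ₂) SUTilde _ (biAction Γ₁ Γ₂)))

/-- A half-space of `L̃`: one of the two sides `I_a`, `H_a` of a hypersurface `E_a`, `a ∈ G̃`. -/
def IsHalfSpace (S : Set LTilde) : Prop := ∃ a : SUTilde, S = halfI a ∨ S = halfH a

/-- A compact polyhedron in `L̃`: a finite union of compact sets, each of which is a finite
intersection of half-spaces. -/
def IsCompactPolyhedron (S : Set LTilde) : Prop :=
  ∃ 𝒞 : Set (Set LTilde), 𝒞.Finite ∧ S = ⋃₀ 𝒞 ∧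
    ∀ C ∈ 𝒞, IsCompact C ∧
      ∃ 𝓢 : Set (Set LTilde), 𝓢.Finite ∧ (∀ X ∈ 𝓢, IsHalfSpace X) ∧ C = ⋂₀ 𝓢

end

noncomputable section

/-! ### Topology and size estimates on G̃ -/

namespace SUTilde

/-! In polar coordinates q = t • h, with t > 0 and h ∈ G̃, put `height g q` = t κ(g⁻¹h), where κ = r
cos α on the sheet |α| < π/2 and 0 elsewhere. Then I_g, H_g and E_g are the sets where the height is
≥ 1, ≤ 1 and = 1 (`halfI_eq`, `halfH_eq`, `frontier_halfH`), and κ is invariant under conjugation.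

The group Γ₂ is commutative and contains a non-trivial rotation around u, so it consists of
rotations around u. The angles occurring in Γ_i at u are the multiples of kπ/p_i, and together they
generate the multiples of ϑ = kπ/lcm(p₁,p₂), which is less than π exactly because the lcm exceeds k.
Hence the elements g₁g₂ with g₁u = au form the coset of a modulo rotations through multiples of ϑ
(`image_setT`), and P is the union over these cosets of the intersections of the H_g.

Along such a coset the height is t r(n) cos(arg n − mϑ), cut off at zero, with n = b⁻¹a⁻¹hb and b •
0 = u. Some m brings the angle within ϑ/2 < π/2, so in a prism t r(n) ≤ 1/cos(ϑ/2)
(`le_of_forall_height_le_one`), and t r(n) ≤ 1 is sufficient for lying in it. With discreteness the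
necessary bound gives local finiteness (`locFin_rotCoset`). With co-compactness the sufficient one
puts all points with small t into the interior of P, so t is bounded below on ∂P
(`exists_lt_t_of_mem_frontier`). A point of F_g is a limit of points of ∂P lying in the prism of g,
and it has height 1 over g; all its coordinates are thereby bounded, and F_g is compact
(`isCompact_face`).

For the polyhedral structure, E_g has affine charts in which the relevant heights are max(0, 1 − l)
with l linear (`exists_chart`). Whether a point of E_g off the other hypersurfaces lies in the face
depends only on the signs of finitely many l. So near each of its points F_g is a finite union of
closed cells of a hyperplane arrangement, cut down to a small box bounded by half-spaces
(`exists_local_cells`), and compactness leaves finitely many cells. -/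

theorem continuous_coord : Continuous fun g : SUTilde => (g.z, g.arg) := continuous_induced_dom

theorem continuous_z : Continuous SUTilde.z := continuous_fst.comp continuous_coord

theorem continuous_arg : Continuous SUTilde.arg := continuous_snd.comp continuous_coord

theorem continuous_r : Continuous SUTilde.r :=
  Real.continuous_sqrt.comp (continuous_const.add (continuous_z.norm.pow 2))

theorem continuous_w : Continuous SUTilde.w := by
  unfold w
  have h1 := continuous_r
  have h2 := continuous_arg
  fun_prop

theorem continuous_mk : Continuous fun p : ℂ × ℝ => (⟨p.1, p.2⟩ : SUTilde) :=
  continuous_induced_rng.2 continuous_id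

/-- The homeomorphism of `G̃` with `ℂ × ℝ` given by the coordinates. -/
def coordHomeo : SUTilde ≃ₜ ℂ × ℝ where
  toFun g := (g.z, g.arg)
  invFun p := ⟨p.1, p.2⟩
  left_inv _ := rfl
  right_inv _ := rfl
  continuous_toFun := continuous_coord
  continuous_invFun := continuous_mk

instance : T2Space SUTilde := coordHomeo.isEmbedding.t2Space

instance : PreconnectedSpace SUTilde := coordHomeo.symm.surjective.denseRange.preconnectedSpace
  coordHomeo.symm.continuous

instance : IsTopologicalGroup SUTilde where
  continuous_mul := by
    refine continuous_induced_rng.2 (Continuous.prodMk ?_ ?_)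
    · have h1 := continuous_z
      have h2 := continuous_w
      change Continuous fun p : SUTilde × SUTilde => conj p.1.w * p.2.z + p.1.z * p.2.w
      have h3 := Complex.continuous_conj
      fun_prop
    · change Continuous fun p : SUTilde × SUTilde =>
        p.1.arg + p.2.arg + Complex.arg (1 + conj p.1.z * p.2.z / (p.1.w * p.2.w))
      have h1 := continuous_z
      have h2 := continuous_w
      have h3 := Complex.continuous_conj
      have h4 := continuous_arg
      refine (by fun_prop : Continuous fun p : SUTilde × SUTilde => p.1.arg + p.2.arg).add ?_
      refine continuous_iff_continuousAt.2 fun p => ?_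
      refine ContinuousAt.comp (g := Complex.arg)
        (Complex.continuousAt_arg (Or.inl (re_pos p.1 p.2))) ?_
      refine Continuous.continuousAt (continuous_const.add (Continuous.div (by fun_prop)
        (by fun_prop) fun q => mul_ne_zero q.1.w_ne_zero q.2.w_ne_zero))
  continuous_inv := by
    refine continuous_induced_rng.2 (Continuous.prodMk ?_ ?_)
    · exact continuous_z.neg
    · exact continuous_arg.neg

theorem isCompact_bounded (C D : ℝ) : IsCompact {g : SUTilde | g.r ≤ C ∧ |g.arg| ≤ D} := by
  have h1 : IsCompact (coordHomeo ⁻¹' (Metric.closedBall 0 C ×ˢ Metric.closedBall 0 D)) :=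
    coordHomeo.isCompact_preimage.2
      ((isCompact_closedBall _ _).prod (isCompact_closedBall _ _))
  refine h1.of_isClosed_subset ?_ ?_
  · exact (isClosed_le continuous_r continuous_const).inter
      (isClosed_le continuous_arg.abs continuous_const)
  · rintro g ⟨hg, hg'⟩
    refine ⟨?_, ?_⟩
    · exact mem_closedBall_zero_iff.2 (g.norm_z_lt_r.le.trans hg)
    · exact mem_closedBall_zero_iff.2 hg'

theorem one_le_r (g : SUTilde) : 1 ≤ g.r := by
  rw [r, Real.one_le_sqrt]; nlinarith [sq_nonneg ‖g.z‖]

theorem r_mul_le (g h : SUTilde) : (g * h).r ≤ 2 * g.r * h.r := by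
  rw [← norm_w, mul_w]
  refine (norm_add_le _ _).trans ?_
  rw [norm_mul, norm_mul, Complex.norm_conj, norm_w, norm_w]
  have := mul_le_mul g.norm_z_lt_r.le h.norm_z_lt_r.le (norm_nonneg _) g.r_pos.le
  linarith

theorem r_inv (g : SUTilde) : g⁻¹.r = g.r := by
  rw [← norm_w, inv_w, Complex.norm_conj, norm_w]

theorem w_re (g : SUTilde) : g.w.re = g.r * Real.cos g.arg := by
  rw [w, Complex.re_ofReal_mul, Complex.exp_ofReal_mul_I_re]

theorem abs_mul_arg_sub_lt (g h : SUTilde) : |(g * h).arg - (g.arg + h.arg)| < Real.pi / 2 := by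
  rw [mul_arg]; simpa using abs_arg_lt g h

end SUTilde

/-! ### The cut-off cosine and the conjugation-invariant function κ -/

/-- The cosine, cut off outside `[-π/2, π/2]`. -/
def cosCut (x : ℝ) : ℝ := Real.cos (min |x| (Real.pi / 2))

theorem continuous_cosCut : Continuous cosCut := by unfold cosCut; fun_prop

theorem cosCut_of_le {x : ℝ} (h : |x| ≤ Real.pi / 2) : cosCut x = Real.cos x := by
  rw [cosCut, min_eq_left h, Real.cos_abs]

theorem cosCut_of_ge {x : ℝ} (h : Real.pi / 2 ≤ |x|) : cosCut x = 0 := by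
  rw [cosCut, min_eq_right h, Real.cos_pi_div_two]

theorem cosCut_nonneg (x : ℝ) : 0 ≤ cosCut x :=
  Real.cos_nonneg_of_neg_pi_div_two_le_of_le
    ((by linarith [Real.pi_pos] : -(Real.pi / 2) ≤ 0).trans
      (le_min (abs_nonneg _) Real.pi_div_two_pos.le)) (min_le_right _ _)

theorem cosCut_le_one (x : ℝ) : cosCut x ≤ 1 := Real.cos_le_one _

theorem cosCut_pos_iff {x : ℝ} : 0 < cosCut x ↔ |x| < Real.pi / 2 := by
  refine ⟨fun h => not_le.1 fun hx => (cosCut_of_ge hx ▸ h).ne rfl, fun h => ?_⟩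
  rw [cosCut_of_le h.le]
  exact Real.cos_pos_of_mem_Ioo (abs_lt.1 h)

theorem cosCut_neg (x : ℝ) : cosCut (-x) = cosCut x := by rw [cosCut, abs_neg, cosCut]

theorem abs_lt_pi_div_two_of_cos_pos {x : ℝ} (h : 0 < Real.cos x)
    (hx : |x| < 3 * (Real.pi / 2)) : |x| < Real.pi / 2 := by
  by_contra! h'
  rw [← Real.cos_abs] at h
  exact h.not_ge (Real.cos_nonpos_of_pi_div_two_le_of_le h' (by linarith))

namespace SUTilde

/-- The function `r cos α` on the sheet `|α| < π/2` of `G̃`, extended by zero. -/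
def kappa (g : SUTilde) : ℝ := g.r * cosCut g.arg

theorem continuous_kappa : Continuous kappa :=
  continuous_r.mul (continuous_cosCut.comp continuous_arg)

theorem kappa_nonneg (g : SUTilde) : 0 ≤ g.kappa := mul_nonneg g.r_pos.le (cosCut_nonneg _)

theorem kappa_pos_iff {g : SUTilde} : 0 < g.kappa ↔ |g.arg| < Real.pi / 2 := by
  rw [kappa, mul_pos_iff_of_pos_left g.r_pos, cosCut_pos_iff]

theorem kappa_of_le {g : SUTilde} (h : |g.arg| ≤ Real.pi / 2) : g.kappa = g.w.re := by
  rw [kappa, cosCut_of_le h, w_re]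

theorem kappa_eq_re {g : SUTilde} (h : 0 < g.kappa) : g.kappa = g.w.re :=
  kappa_of_le (kappa_pos_iff.1 h).le

theorem kappa_inv (g : SUTilde) : g⁻¹.kappa = g.kappa := by
  rw [kappa, kappa, r_inv, inv_arg, cosCut_neg]

theorem kappa_one : (1 : SUTilde).kappa = 1 := by
  rw [kappa_of_le, one_w, Complex.one_re]
  rw [one_arg, abs_zero]; exact Real.pi_div_two_pos.le

theorem cos_arg_pos_iff {g : SUTilde} : 0 < Real.cos g.arg ↔ 0 < g.w.re := by
  rw [w_re, mul_pos_iff_of_pos_left g.r_pos]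

/-- The real part of w is half the trace of the matrix. -/
theorem conj_w_re (a h : SUTilde) : (a * h * a⁻¹).w.re = h.w.re := by
  have e : (a * h * a⁻¹).w = h.w.re + ((a.w * conj a.w + a.z * conj a.z) * h.w.im
      + 2 * ((conj a.w * conj a.z * h.z).im : ℝ)) * Complex.I := by
    have e1 := a.w_mul_conj
    rw [mul_w, mul_w, mul_z, inv_w, inv_z]
    simp only [map_add, map_mul, Complex.conj_conj]
    have h2 : ((2 * (conj a.w * conj a.z * h.z).im : ℝ) : ℂ) * Complex.I =
        conj a.w * conj a.z * h.z - a.w * a.z * conj h.z := by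
      have := Complex.sub_conj (conj a.w * conj a.z * h.z)
      simp only [map_mul, Complex.conj_conj] at this
      rw [this]
    have h3 : (h.w.re : ℂ) = (h.w + conj h.w) / 2 := by
      rw [Complex.add_conj]; push_cast; ring
    have h4 : (h.w.im : ℂ) * Complex.I = (h.w - conj h.w) / 2 := by
      rw [Complex.sub_conj]; push_cast; ring
    push_cast at h2
    linear_combination (h.w / 2 + conj h.w / 2) * e1 - h3
      - (a.w * conj a.w + a.z * conj a.z) * h4 - h2
  rw [e, Complex.mul_conj, Complex.mul_conj]
  simp [← Complex.ofReal_add, ← Complex.ofReal_mul]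

/-- Only the sheet needs an argument, since Re w is invariant. As a varies over the connected group,
|arg| of the conjugate cannot reach π/2, for there Re w would vanish. -/
theorem kappa_conj_of_pos {h : SUTilde} (hh : 0 < h.kappa) (a : SUTilde) :
    (a * h * a⁻¹).kappa = h.kappa := by
  have hre : 0 < h.w.re := kappa_eq_re hh ▸ hh
  have hc0 : Continuous fun a : SUTilde => a * h * a⁻¹ :=
    (continuous_id.mul continuous_const).mul continuous_inv
  have hc : Continuous fun a : SUTilde => |(a * h * a⁻¹).arg| :=
    (continuous_arg.comp hc0).abs
  have key : |(a * h * a⁻¹).arg| < Real.pi / 2 := by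
    by_contra! hcon
    have h1 : |(1 * h * 1⁻¹ : SUTilde).arg| ≤ Real.pi / 2 := by
      rw [one_mul, inv_one, mul_one]; exact (kappa_pos_iff.1 hh).le
    obtain ⟨c, hc'⟩ := mem_range_of_exists_le_of_exists_ge hc ⟨1, h1⟩ ⟨a, hcon⟩
    have h2 : 0 < Real.cos (c * h * c⁻¹).arg := cos_arg_pos_iff.2 (by rwa [conj_w_re])
    rw [← Real.cos_abs] at h2
    simp only at hc'
    rw [hc', Real.cos_pi_div_two] at h2
    exact lt_irrefl _ h2
  rw [kappa_of_le key.le, conj_w_re, kappa_eq_re hh]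

theorem kappa_conj (a h : SUTilde) : (a * h * a⁻¹).kappa = h.kappa := by
  rcases h.kappa_nonneg.eq_or_lt with h0 | h0
  · rcases (a * h * a⁻¹).kappa_nonneg.eq_or_lt with h1 | h1
    · rw [← h0, ← h1]
    · have := kappa_conj_of_pos h1 a⁻¹
      rw [← this]; congr 1; group
  · exact kappa_conj_of_pos h0 a

theorem kappa_mul_comm (a h : SUTilde) : (a * h).kappa = (h * a).kappa := by
  rw [← kappa_conj a (h * a)]; congr 1; group

/-- On the sheet `|α| < π/2` the function `κ(s⁻¹ m)` is the positive part of `Re w(s⁻¹ m)`. -/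
theorem kappa_inv_mul {s m : SUTilde} (hs : |s.arg| < Real.pi / 2) (hm : |m.arg| < Real.pi / 2) :
    (s⁻¹ * m).kappa = max 0 (s⁻¹ * m).w.re := by
  -- The two arguments and the correction term of the product are each less than π/2. Below 3π/2 a
  -- positive cosine already forces the sheet |α| < π/2.
  have hk : |(s⁻¹ * m).arg| < 3 * (Real.pi / 2) := by
    have h1 := abs_lt.1 (abs_mul_arg_sub_lt s⁻¹ m)
    rw [inv_arg] at h1
    rw [abs_lt] at *
    constructor <;> linarith [h1.1, h1.2, hs.1, hs.2, hm.1, hm.2]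
  rcases lt_or_ge 0 (s⁻¹ * m).w.re with h | h
  · rw [max_eq_right h.le,
      kappa_of_le (abs_lt_pi_div_two_of_cos_pos (cos_arg_pos_iff.2 h) hk).le]
  · rw [max_eq_left h]
    refine le_antisymm (not_lt.1 fun hcon => ?_) (kappa_nonneg _)
    have := kappa_eq_re hcon
    linarith

end SUTilde

/-! ### Polar coordinates on L̃ and half-spaces in terms of heights -/

namespace LTilde

theorem continuous_coord : Continuous fun q : LTilde => (q.z, q.arg, q.r) :=
  continuous_induced_dom

theorem continuous_z : Continuous LTilde.z := continuous_fst.comp continuous_coord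

theorem continuous_arg : Continuous LTilde.arg :=
  continuous_fst.comp (continuous_snd.comp continuous_coord)

theorem continuous_r : Continuous LTilde.r :=
  continuous_snd.comp (continuous_snd.comp continuous_coord)

theorem sq_pos (q : LTilde) : 0 < q.r ^ 2 - ‖q.z‖ ^ 2 := by
  have := q.norm_lt
  nlinarith [norm_nonneg q.z]

/-- The radial coordinate `t` of a point `q = t • h` of `L̃`, with `h ∈ G̃`. -/
def t (q : LTilde) : ℝ := Real.sqrt (q.r ^ 2 - ‖q.z‖ ^ 2)

theorem t_pos (q : LTilde) : 0 < q.t := Real.sqrt_pos.2 q.sq_pos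

theorem t_sq (q : LTilde) : q.t ^ 2 = q.r ^ 2 - ‖q.z‖ ^ 2 := Real.sq_sqrt q.sq_pos.le

/-- The radial projection `L̃ → G̃`. -/
def h (q : LTilde) : SUTilde := ⟨q.z / q.t, q.arg⟩

theorem h_z (q : LTilde) : q.h.z = q.z / q.t := rfl

theorem h_arg (q : LTilde) : q.h.arg = q.arg := rfl

theorem h_r (q : LTilde) : q.h.r = q.r / q.t := by
  have h0 : 0 < q.r := (norm_nonneg _).trans_lt q.norm_lt
  have ht := q.t_pos
  rw [SUTilde.r, h_z, norm_div, Complex.norm_real, Real.norm_eq_abs, abs_of_pos ht,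
    Real.sqrt_eq_iff_mul_self_eq (by positivity) (by positivity)]
  have := q.t_sq
  field_simp
  linarith

theorem continuous_t : Continuous LTilde.t :=
  Real.continuous_sqrt.comp ((continuous_r.pow 2).sub (continuous_z.norm.pow 2))

theorem continuous_h : Continuous LTilde.h := by
  refine continuous_induced_rng.2 (Continuous.prodMk ?_ continuous_arg)
  exact continuous_z.div (Complex.continuous_ofReal.comp continuous_t)
    fun q => by exact_mod_cast q.t_pos.ne'

/-- The point `t • h` of `L̃`. -/
def scale (h : SUTilde) (t : Ioi (0 : ℝ)) : LTilde :=
  ⟨t * h.z, h.arg, t * h.r, by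
    have ht : (0 : ℝ) < t := t.2
    rw [norm_mul, Complex.norm_real, Real.norm_eq_abs, abs_of_pos ht]
    exact mul_lt_mul_of_pos_left h.norm_z_lt_r ht⟩

theorem scale_t (h : SUTilde) (t : Ioi (0 : ℝ)) : (scale h t).t = t := by
  have ht : (0 : ℝ) < t := t.2
  rw [LTilde.t, Real.sqrt_eq_iff_mul_self_eq (scale h t).sq_pos.le ht.le]
  simp only [scale, norm_mul, Complex.norm_real, Real.norm_eq_abs, abs_of_pos ht]
  have := h.r_sq
  linear_combination ((t : ℝ) ^ 2) * this

theorem scale_h (h : SUTilde) (t : Ioi (0 : ℝ)) : (scale h t).h = h := by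
  have ht : ((t : ℝ) : ℂ) ≠ 0 := by exact_mod_cast (ne_of_gt t.2)
  ext1
  · rw [h_z, scale_t]
    exact mul_div_cancel_left₀ _ ht
  · rfl

theorem scale_h_t (q : LTilde) : scale q.h ⟨q.t, q.t_pos⟩ = q := by
  have ht := q.t_pos
  have ht' : (q.t : ℂ) ≠ 0 := by exact_mod_cast ht.ne'
  ext1
  · change (q.t : ℂ) * (q.z / q.t) = q.z
    field_simp
  · rfl
  · change q.t * q.h.r = q.r
    rw [h_r]; field_simp

theorem continuous_scale : Continuous fun p : SUTilde × Ioi (0 : ℝ) => scale p.1 p.2 := by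
  refine continuous_induced_rng.2 ?_
  change Continuous fun p : SUTilde × Ioi (0 : ℝ) =>
    (((p.2 : ℝ) : ℂ) * p.1.z, p.1.arg, (p.2 : ℝ) * p.1.r)
  have h1 := SUTilde.continuous_z
  have h2 := SUTilde.continuous_arg
  have h3 := SUTilde.continuous_r
  fun_prop

/-- The homeomorphism `L̃ ≃ G̃ × (0, ∞)`. -/
def polar : LTilde ≃ₜ SUTilde × Ioi (0 : ℝ) where
  toFun q := (q.h, ⟨q.t, q.t_pos⟩)
  invFun p := scale p.1 p.2
  left_inv q := q.scale_h_t
  right_inv _ := Prod.ext (scale_h _ _) (Subtype.ext (scale_t _ _))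
  continuous_toFun := continuous_h.prodMk (continuous_t.subtype_mk _)
  continuous_invFun := continuous_scale

instance : T2Space LTilde := polar.isEmbedding.t2Space

theorem ext_polar {p q : LTilde} (hh : p.h = q.h) (ht : p.t = q.t) : p = q :=
  polar.injective (Prod.ext hh (Subtype.ext ht))

theorem toL_t (g : SUTilde) : g.toL.t = 1 := by
  rw [t, SUTilde.toL, Real.sqrt_eq_one, SUTilde.r_sq]; ring

theorem toL_h (g : SUTilde) : g.toL.h = g := by
  ext1
  · rw [h_z, toL_t, Complex.ofReal_one, div_one]; rfl
  · rfl

/-- The height `t κ(g⁻¹ h)` of the point `q = t • h` over `g`: the half-spaces `I_g` and `H_g`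
are given by height at least, respectively at most, one. -/
def height (g : SUTilde) (q : LTilde) : ℝ := q.t * (g⁻¹ * q.h).kappa

theorem continuous_height (g : SUTilde) : Continuous (height g) :=
  continuous_t.mul (SUTilde.continuous_kappa.comp (continuous_const.mul continuous_h))

theorem proj_snd (q : LTilde) : q.proj.2 = q.t * q.h.w := by
  have ht : (q.t : ℂ) ≠ 0 := by exact_mod_cast q.t_pos.ne'
  rw [SUTilde.w, h_r, h_arg, proj]
  push_cast
  field_simp

theorem proj_fst (q : LTilde) : q.proj.1 = q.t * q.h.z := by
  have ht : (q.t : ℂ) ≠ 0 := by exact_mod_cast q.t_pos.ne'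
  rw [h_z, proj]
  field_simp

theorem inv_mul_w (g h : SUTilde) : (g⁻¹ * h).w = conj g.w * h.w - conj g.z * h.z := by
  rw [SUTilde.mul_w, SUTilde.inv_w, SUTilde.inv_z, map_neg]; ring

theorem form22_eq (g : SUTilde) (q : LTilde) :
    form22 g.toL.proj q.proj = -(q.t * (g⁻¹ * q.h).w.re) := by
  rw [form22, proj_fst, proj_snd, proj_fst, proj_snd, toL_t, toL_h, inv_mul_w]
  simp
  ring

theorem form22_le_iff (g : SUTilde) (q : LTilde) :
    form22 g.toL.proj q.proj ≤ -1 ↔ 1 ≤ q.t * (g⁻¹ * q.h).w.re := by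
  rw [form22_eq, neg_le_neg_iff]

theorem abs_arg_lt_of_height_pos {g : SUTilde} {q : LTilde} (h : 0 < height g q) :
    |(g⁻¹ * q.h).arg| < Real.pi / 2 :=
  SUTilde.kappa_pos_iff.1 ((mul_pos_iff_of_pos_left q.t_pos).1 h)

theorem height_scale (g h : SUTilde) (t : Ioi (0 : ℝ)) :
    height g (scale h t) = t * (g⁻¹ * h).kappa := by rw [height, scale_t, scale_h]

theorem height_toL (g : SUTilde) : height g g.toL = 1 := by
  rw [height, toL_t, toL_h, inv_mul_cancel, SUTilde.kappa_one, one_mul]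

/-- The set is the continuous image of a convex set: the coordinates of g⁻¹h on the sheet |α| < π/2,
together with the height itself, parametrise it. -/
theorem isPreconnected_one_le_height (g : SUTilde) :
    IsPreconnected {q : LTilde | 1 ≤ height g q} := by
  set D : Set (ℂ × ℝ × ℝ) := univ ×ˢ Ioo (-(Real.pi / 2)) (Real.pi / 2) ×ˢ Ici 1 with hD
  have hDc : IsPreconnected D :=
    (convex_univ.prod ((convex_Ioo _ _).prod (convex_Ici _))).isPreconnected
  have hpos : ∀ d : D, 0 < (⟨d.1.1, d.1.2.1⟩ : SUTilde).kappa := fun d =>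
    SUTilde.kappa_pos_iff.2 (abs_lt.2 d.2.2.1)
  have hone : ∀ d : D, (0 : ℝ) < d.1.2.2 := fun d => zero_lt_one.trans_le d.2.2.2
  let f : D → LTilde := fun d => scale (g * ⟨d.1.1, d.1.2.1⟩)
    ⟨d.1.2.2 / (⟨d.1.1, d.1.2.1⟩ : SUTilde).kappa, div_pos (hone d) (hpos d)⟩
  have hm : Continuous fun d : D => (⟨d.1.1, d.1.2.1⟩ : SUTilde) :=
    SUTilde.continuous_mk.comp (by fun_prop : Continuous fun d : D => (d.1.1, d.1.2.1))
  have hf : Continuous f := by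
    refine continuous_scale.comp ((continuous_const.mul hm).prodMk (Continuous.subtype_mk ?_ _))
    exact Continuous.div (by fun_prop) (SUTilde.continuous_kappa.comp hm) fun d => (hpos d).ne'
  have hr : {q : LTilde | 1 ≤ height g q} = range f := by
    ext q
    constructor
    · intro hq
      have ha := abs_arg_lt_of_height_pos (zero_lt_one.trans_le hq)
      have hk := SUTilde.kappa_pos_iff.2 ha
      refine ⟨⟨((g⁻¹ * q.h).z, (g⁻¹ * q.h).arg, height g q), mem_univ _, abs_lt.1 ha, hq⟩, ?_⟩
      refine ext_polar ?_ ?_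
      · simp only [f, scale_h]
        change g * (g⁻¹ * q.h) = q.h
        group
      · simp only [f, scale_t]
        change height g q / (g⁻¹ * q.h).kappa = q.t
        rw [height, mul_div_cancel_right₀ _ hk.ne']
    · rintro ⟨d, rfl⟩
      simp only [f, mem_ofPred_eq, height_scale]
      rw [inv_mul_cancel_left, div_mul_cancel₀ _ (hpos d).ne']
      exact d.2.2.2
  have : PreconnectedSpace D := isPreconnected_iff_preconnectedSpace.1 hDc
  rw [hr]
  exact isPreconnected_range hf

/-- On the component Re w(g⁻¹h) > 0, so |arg| starts at 0 and never equals π/2; there κ is Re w. The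
other inclusion is connectedness of the right-hand side. -/
theorem halfI_eq (g : SUTilde) : halfI g = {q | 1 ≤ height g q} := by
  have hg : form22 g.toL.proj g.toL.proj ≤ -1 := by
    rw [form22_le_iff, toL_h, toL_t, inv_mul_cancel, SUTilde.one_w]; simp
  refine Subset.antisymm (fun q hq => ?_) ?_
  · have hsub := connectedComponentIn_subset
      {q : LTilde | form22 g.toL.proj q.proj ≤ -1} g.toL
    have hC : IsPreconnected (halfI g) := isPreconnected_connectedComponentIn
    have hgm : g.toL ∈ halfI g := mem_connectedComponentIn hg
    have hre : ∀ q ∈ halfI g, 0 < (g⁻¹ * q.h).w.re := fun q hq => by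
      have h1 := (form22_le_iff g q).1 (hsub hq)
      exact (mul_pos_iff_of_pos_left q.t_pos).1 (zero_lt_one.trans_le h1)
    have hcont : Continuous fun q : LTilde => |(g⁻¹ * q.h).arg| :=
      (SUTilde.continuous_arg.comp (continuous_const.mul continuous_h)).abs
    have ha : |(g⁻¹ * q.h).arg| < Real.pi / 2 := by
      by_contra! hcon
      have h0 : |(g⁻¹ * g.toL.h).arg| ≤ Real.pi / 2 := by
        rw [toL_h, inv_mul_cancel, SUTilde.one_arg, abs_zero]; exact Real.pi_div_two_pos.le
      obtain ⟨c, hc, hc'⟩ := hC.intermediate_value hgm hq hcont.continuousOn ⟨h0, hcon⟩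
      have h2 := SUTilde.cos_arg_pos_iff.2 (hre c hc)
      rw [← Real.cos_abs] at h2
      simp only at hc'
      rw [hc', Real.cos_pi_div_two] at h2
      exact lt_irrefl _ h2
    have h1 := (form22_le_iff g q).1 (hsub hq)
    rwa [← SUTilde.kappa_of_le ha.le] at h1
  · refine (isPreconnected_one_le_height g).subset_connectedComponentIn
      (height_toL g).ge fun q (hq : 1 ≤ height g q) => ?_
    refine (form22_le_iff g q).2 ?_
    have hk := SUTilde.kappa_pos_iff.2 (abs_arg_lt_of_height_pos (zero_lt_one.trans_le hq))
    rwa [← SUTilde.kappa_eq_re hk]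

theorem continuous_scale_right (h : SUTilde) : Continuous (scale h) :=
  continuous_scale.comp (Continuous.prodMk_right h)

/-- A neighbourhood of `q` contains the points `s • q` for `s` close to `1`. -/
theorem eventually_scale {q : LTilde} {N : Set LTilde} (hN : N ∈ 𝓝 q) :
    ∃ ε > 0, ε < q.t ∧ ∀ s : Ioi (0 : ℝ), |(s : ℝ) - q.t| < ε → scale q.h s ∈ N := by
  have h1 : Filter.Tendsto (scale q.h) (𝓝 ⟨q.t, q.t_pos⟩) (𝓝 q) := by
    have := (continuous_scale_right q.h).tendsto ⟨q.t, q.t_pos⟩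
    rwa [scale_h_t] at this
  obtain ⟨ε, hε, hs⟩ := Metric.mem_nhds_iff.1 (h1 hN)
  refine ⟨min ε (q.t / 2), lt_min hε (half_pos q.t_pos),
    (min_le_right _ _).trans_lt (half_lt_self q.t_pos), fun s hs' => hs ?_⟩
  exact hs'.trans_le (min_le_left _ _)

/-- Positive heights decrease strictly when a point is moved towards the origin along its ray, so
height ≤ 1 is approximated by height < 1. -/
theorem halfH_eq (g : SUTilde) : halfH g = {q | height g q ≤ 1} := by
  have hc : (halfI g)ᶜ = {q | height g q < 1} := by ext q; simp [halfI_eq]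
  rw [halfH, hc]
  refine Subset.antisymm (closure_minimal (fun q (hq : height g q < 1) => hq.le)
    (isClosed_le (continuous_height g) continuous_const)) fun q (hq : height g q ≤ 1) => ?_
  rw [mem_closure_iff_nhds]
  intro N hN
  obtain ⟨ε, hε, hεt, hs⟩ := eventually_scale hN
  have hp : 0 < q.t - ε / 2 := by linarith
  refine ⟨scale q.h ⟨q.t - ε / 2, hp⟩, hs _ ?_, ?_⟩
  · simp only [sub_sub_cancel_left, abs_neg]
    rw [abs_of_pos (half_pos hε)]; exact half_lt_self hε
  · change height g _ < 1
    rw [height_scale]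
    rw [height] at hq
    rcases (g⁻¹ * q.h).kappa_nonneg.eq_or_lt with h0 | h0
    · rw [← h0, mul_zero]; exact zero_lt_one
    · refine lt_of_lt_of_le ?_ hq
      exact mul_lt_mul_of_pos_right (by linarith : q.t - ε / 2 < q.t) h0

theorem frontier_halfH (g : SUTilde) : frontier (halfH g) = {q | height g q = 1} := by
  have hcl : IsClosed {q : LTilde | height g q ≤ 1} :=
    isClosed_le (continuous_height g) continuous_const
  rw [halfH_eq, hcl.frontier_eq]
  ext q
  constructor
  · rintro ⟨h1, h2⟩
    refine le_antisymm h1 (not_lt.1 fun h3 => h2 ?_)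
    exact interior_maximal (fun q (hq : height g q < 1) => hq.le)
      (isOpen_lt (continuous_height g) continuous_const) h3
  · intro (hq : height g q = 1)
    refine ⟨hq.le, fun hin => ?_⟩
    obtain ⟨ε, hε, hεt, hs⟩ := eventually_scale (mem_interior_iff_mem_nhds.1 hin)
    have hp : 0 < q.t + ε / 2 := by linarith [q.t_pos]
    have h1 : height g (scale q.h ⟨q.t + ε / 2, hp⟩) ≤ 1 := hs _ (by
      simp only [add_sub_cancel_left]
      rw [abs_of_pos (half_pos hε)]; exact half_lt_self hε)
    rw [height_scale] at h1
    have h0 : 0 < (g⁻¹ * q.h).kappa :=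
      SUTilde.kappa_pos_iff.2 (abs_arg_lt_of_height_pos (hq ▸ zero_lt_one))
    rw [height] at hq
    have : (0 : ℝ) < ε / 2 * (g⁻¹ * q.h).kappa := by positivity
    simp only at h1
    linarith

/-- The point of the sheet `|α| ≤ π` of `L̃` over `(z, w)`. -/
def ofPair (z w : ℂ) (h : ‖z‖ < ‖w‖) : LTilde := ⟨z, Complex.arg w, ‖w‖, h⟩

theorem ofPair_z (z w : ℂ) (h : ‖z‖ < ‖w‖) :
    ((ofPair z w h).t : ℂ) * (ofPair z w h).h.z = z := by
  rw [← proj_fst]; rfl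

theorem ofPair_w (z w : ℂ) (h : ‖z‖ < ‖w‖) :
    ((ofPair z w h).t : ℂ) * (ofPair z w h).h.w = w := by
  rw [← proj_snd]; exact Complex.norm_mul_exp_arg_mul_I w

theorem ofPair_arg (z w : ℂ) (h : ‖z‖ < ‖w‖) : (ofPair z w h).h.arg = Complex.arg w := rfl

/-- The left translation of `L̃` by an element of `G̃`. -/
def translate (g : SUTilde) (q : LTilde) : LTilde := scale (g * q.h) ⟨q.t, q.t_pos⟩

theorem translate_h (g : SUTilde) (q : LTilde) : (translate g q).h = g * q.h := scale_h _ _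

theorem translate_t (g : SUTilde) (q : LTilde) : (translate g q).t = q.t := scale_t _ _

theorem translate_inv_translate (g : SUTilde) (q : LTilde) :
    translate g (translate g⁻¹ q) = q := by
  refine ext_polar ?_ ?_
  · rw [translate_h, translate_h, mul_inv_cancel_left]
  · rw [translate_t, translate_t]

theorem continuous_translate (g : SUTilde) : Continuous (translate g) :=
  continuous_scale.comp ((continuous_const.mul continuous_h).prodMk (continuous_t.subtype_mk _))

theorem height_translate (g s : SUTilde) (q : LTilde) :
    height (g * s) (translate g q) = height s q := by
  rw [height, height, translate_t, translate_h, mul_inv_rev, mul_assoc, inv_mul_cancel_left]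

theorem height_of_abs_arg_lt {s : SUTilde} {q : LTilde} (hs : |s.arg| < Real.pi / 2)
    (hq : |q.h.arg| < Real.pi / 2) :
    height s q = max 0 (conj s.w * (q.t * q.h.w) - conj s.z * (q.t * q.h.z)).re := by
  have e : (conj s.w * (q.t * q.h.w) - conj s.z * (q.t * q.h.z)).re
      = q.t * (s⁻¹ * q.h).w.re := by
    rw [inv_mul_w, ← Complex.re_ofReal_mul]; congr 1; ring
  rw [e, height, SUTilde.kappa_inv_mul hs hq, mul_max_of_nonneg _ _ q.t_pos.le, mul_zero]

theorem re_of_height_pos {s : SUTilde} {q : LTilde} (h : 0 < height s q) :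
    height s q = (conj s.w * (q.t * q.h.w) - conj s.z * (q.t * q.h.z)).re := by
  have e : (conj s.w * (q.t * q.h.w) - conj s.z * (q.t * q.h.z)).re
      = q.t * (s⁻¹ * q.h).w.re := by
    rw [inv_mul_w, ← Complex.re_ofReal_mul]; congr 1; ring
  rw [e, height,
    SUTilde.kappa_eq_re (SUTilde.kappa_pos_iff.2 (abs_arg_lt_of_height_pos h))]

end LTilde

namespace SUTilde

/-- The point of the sheet `|α| ≤ π` of `G̃` over `(z, w)`. -/
def ofPair (z w : ℂ) : SUTilde := ⟨z, Complex.arg w⟩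

theorem ofPair_w {z w : ℂ} (h : ‖w‖ ^ 2 = 1 + ‖z‖ ^ 2) : (ofPair z w).w = w := by
  have hr : (ofPair z w).r = ‖w‖ := by
    rw [r, Real.sqrt_eq_iff_mul_self_eq (by positivity) (norm_nonneg _)]
    change 1 + ‖z‖ ^ 2 = ‖w‖ * ‖w‖
    rw [← h, sq]
  rw [SUTilde.w, hr]
  exact Complex.norm_mul_exp_arg_mul_I w

end SUTilde

/-! ### Affine charts of the hypersurfaces and small boxes in them -/

namespace LTilde

/-- The second coordinate of the affine parametrisation of `E_s` around `t • 1`. -/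
def tangentW (s : SUTilde) (t : ℝ) (p : ℂ × ℝ) : ℂ :=
  ⟨t * (1 + (p.1 * conj s.z).re - p.2 * s.w.im), p.2⟩

theorem continuous_tangentW (s : SUTilde) (t : ℝ) : Continuous (tangentW s t) := by
  have h3 := Complex.continuous_conj
  have : tangentW s t = fun p : ℂ × ℝ =>
      ((t * (1 + (p.1 * conj s.z).re - p.2 * s.w.im) : ℝ) : ℂ) + p.2 * Complex.I := by
    ext p; exact (Complex.re_add_im (tangentW s t p)).symm
  rw [this]
  fun_prop

/-- The domain of the affine parametrisation of `E_s` around `t • 1`. -/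
def tangentDom (s : SUTilde) (t : ℝ) : Set (ℂ × ℝ) := {p | ‖p.1‖ < (tangentW s t p).re}

theorem isOpen_tangentDom (s : SUTilde) (t : ℝ) : IsOpen (tangentDom s t) :=
  isOpen_lt continuous_fst.norm (Complex.continuous_re.comp (continuous_tangentW s t))

theorem norm_lt_of_mem_tangentDom {s : SUTilde} {t : ℝ} {p : ℂ × ℝ} (hp : p ∈ tangentDom s t) :
    ‖p.1‖ < ‖tangentW s t p‖ :=
  lt_of_lt_of_le hp (Complex.re_le_norm _)

theorem re_pos_of_mem_tangentDom {s : SUTilde} {t : ℝ} {p : ℂ × ℝ} (hp : p ∈ tangentDom s t) :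
    0 < (tangentW s t p).re :=
  lt_of_le_of_lt (norm_nonneg _) hp

theorem zero_mem_tangentDom (s : SUTilde) {t : ℝ} (ht : 0 < t) : 0 ∈ tangentDom s t := by
  simp [tangentDom, tangentW, ht]

open Classical in
/-- The affine parametrisation of `E_s` around `t • 1`. -/
def tangentMap (s : SUTilde) (t : ℝ) (p : ℂ × ℝ) : LTilde :=
  if h : ‖p.1‖ < ‖tangentW s t p‖ then ofPair p.1 (tangentW s t p) h else (1 : SUTilde).toL

theorem tangentMap_of_mem {s : SUTilde} {t : ℝ} {p : ℂ × ℝ} (hp : p ∈ tangentDom s t) :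
    tangentMap s t p = ofPair p.1 (tangentW s t p) (norm_lt_of_mem_tangentDom hp) :=
  dif_pos _

theorem continuousOn_tangentMap (s : SUTilde) (t : ℝ) :
    ContinuousOn (tangentMap s t) (tangentDom s t) := by
  rw [continuousOn_iff_continuous_domRestrict]
  refine continuous_induced_rng.2 ?_
  have e : (fun q : LTilde => (q.z, q.arg, q.r)) ∘ (tangentDom s t).domRestrict (tangentMap s t) =
      fun p : tangentDom s t =>
        (p.1.1, Complex.arg (tangentW s t p.1), ‖tangentW s t p.1‖) := by
    ext p : 1
    simp only [Function.comp_apply, domRestrict_apply]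
    rw [tangentMap_of_mem p.2]
    rfl
  rw [e]
  have hw := (continuous_tangentW s t).comp (continuous_subtype_val (p := (· ∈ tangentDom s t)))
  refine (continuous_fst.comp continuous_subtype_val).prodMk (Continuous.prodMk ?_ hw.norm)
  refine continuous_iff_continuousAt.2 fun p => ?_
  exact ContinuousAt.comp (g := Complex.arg)
    (Complex.continuousAt_arg (Or.inl (re_pos_of_mem_tangentDom p.2))) hw.continuousAt

theorem abs_arg_tangentMap_lt {s : SUTilde} {t : ℝ} {p : ℂ × ℝ} (hp : p ∈ tangentDom s t) :
    |(tangentMap s t p).h.arg| < Real.pi / 2 := by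
  rw [tangentMap_of_mem hp, ofPair_arg]
  exact Complex.abs_arg_lt_pi_div_two_iff.2 (Or.inl (re_pos_of_mem_tangentDom hp))

theorem height_tangentMap {s s' : SUTilde} {t : ℝ} {p : ℂ × ℝ} (hp : p ∈ tangentDom s t)
    (hs : |s'.arg| < Real.pi / 2) :
    height s' (tangentMap s t p) =
      max 0 (s'.w.re * (tangentW s t p).re + p.2 * s'.w.im - (p.1 * conj s'.z).re) := by
  rw [height_of_abs_arg_lt hs (abs_arg_tangentMap_lt hp), tangentMap_of_mem hp, ofPair_z,
    ofPair_w]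
  congr 1
  simp [tangentW]
  ring

theorem tangentMap_zero (s : SUTilde) {t : ℝ} (ht : 0 < t) :
    tangentMap s t 0 = scale 1 ⟨t, ht⟩ := by
  have hw : tangentW s t 0 = t := by simp [tangentW]; rfl
  rw [tangentMap_of_mem (zero_mem_tangentDom s ht)]
  ext1
  · change (0 : ℂ) = t * 0
    simp
  · change Complex.arg (tangentW s t 0) = 0
    rw [hw, Complex.arg_ofReal_of_nonneg ht.le]
  · change ‖tangentW s t 0‖ = t * (1 : SUTilde).r
    rw [hw, ← SUTilde.norm_w, SUTilde.one_w]
    simp [abs_of_pos ht]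

theorem abs_arg_lt_of_height_scale_one {s : SUTilde} {t : Ioi (0 : ℝ)}
    (h : 0 < height s (scale 1 t)) : |s.arg| < Real.pi / 2 ∧ height s (scale 1 t) = t * s.w.re := by
  have ht : (0 : ℝ) < t := t.2
  rw [height_scale, mul_one, SUTilde.kappa_inv] at *
  have := (mul_pos_iff_of_pos_left ht).1 h
  exact ⟨SUTilde.kappa_pos_iff.1 this, by rw [SUTilde.kappa_eq_re this]⟩

/-- In the affine parametrisation of `E_s` the height over `s'` is one minus this linear form. -/
def tangentForm (s s' : SUTilde) : ℂ × ℝ →ₗ[ℝ] ℝ where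
  toFun p := (p.1 * (conj s'.z - conj s.z)).re - p.2 * (s'.w.im - s.w.im)
  map_add' p q := by simp; ring
  map_smul' c p := by simp; ring

/-- The form records the differences in z and Im w. If it vanishes, s and s' have the same image in
G, and the bound on the arguments makes the lifts equal. -/
theorem tangentForm_ne_zero {s s' : SUTilde} (hs : |s.arg| < Real.pi / 2)
    (hs' : |s'.arg| < Real.pi / 2) (hre : s.w.re = s'.w.re) (hne : s' ≠ s) :
    tangentForm s s' ≠ 0 := by
  intro h0
  apply hne
  have h1 : tangentForm s s' (1, 0) = 0 := by rw [h0]; rfl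
  have h2 : tangentForm s s' (Complex.I, 0) = 0 := by rw [h0]; rfl
  have h3 : tangentForm s s' (0, 1) = 0 := by rw [h0]; rfl
  simp [tangentForm] at h1 h2 h3
  refine SUTilde.eq_of_abs_lt (Complex.ext (by linarith) (by linarith))
    (Complex.ext hre.symm (by linarith)) ?_
  rw [abs_lt] at *
  constructor <;> linarith [hs.1, hs.2, hs'.1, hs'.2, Real.pi_pos]

/-- If E_{s'} also passes through t • 1, the factor t Re w(s') is 1 and the constant terms combine
to exactly 1, so the remaining form is linear, without a constant term. -/
theorem height_tangentMap_eq {s s' : SUTilde} {t : ℝ}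
    (hs' : |s'.arg| < Real.pi / 2) (hre : t * s'.w.re = 1) {p : ℂ × ℝ}
    (hp : p ∈ tangentDom s t) :
    height s' (tangentMap s t p) = max 0 (1 - tangentForm s s' p) := by
  rw [height_tangentMap hp hs']
  congr 1
  simp [tangentForm, tangentW]
  linear_combination (1 + (p.1.re * s.z.re + p.1.im * s.z.im) - p.2 * s.w.im) * hre


/-- A linear form whose sublevel set is cut out by one of the faces of a small box in `E_s`. -/
def boxForm (s : SUTilde) (R Y ε : ℝ) (j : ℂ × ℝ) : ℂ × ℝ →ₗ[ℝ] ℝ where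
  toFun p := (p.1 * (R * conj j.1 - (1 + ε) * conj s.z)).re - p.2 * (j.2 * Y - (1 + ε) * s.w.im)
  map_add' p q := by simp; ring
  map_smul' c p := by simp; ring

/-- The outer directions of the faces of the box. -/
def boxDirs : Set (ℂ × ℝ) := {1, -1, Complex.I, -Complex.I} ×ˢ {1, -1}

theorem finite_boxDirs : boxDirs.Finite := by
  unfold boxDirs
  exact Finite.prod (toFinite _) (toFinite _)

/-- The eight directions bound R|Re z| + Y|y| and R|Im z| + Y|y| by ε plus the tilt E caused by s.
Adding the two, the lower bounds on R and Y absorb both copies of E. -/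
theorem norm_le_of_boxForm_le {s : SUTilde} {R Y ε : ℝ} (hε : 0 ≤ ε) (hε1 : ε ≤ 1)
    (hR : 4 * ‖s.z‖ + 1 ≤ R) (hY : 2 * |s.w.im| + 1 ≤ Y) {p : ℂ × ℝ}
    (hp : ∀ j ∈ boxDirs, boxForm s R Y ε j p ≤ ε) : ‖p‖ ≤ 2 * ε := by
  obtain ⟨z, y⟩ := p
  set E := (1 + ε) * ((z * conj s.z).re - y * s.w.im) with hE
  have hE' : E ≤ 2 * (‖s.z‖ * (|z.re| + |z.im|) + |s.w.im| * |y|) := by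
    have h1 : (z * conj s.z).re ≤ ‖s.z‖ * (|z.re| + |z.im|) := by
      refine (Complex.re_le_norm _).trans ?_
      rw [norm_mul, Complex.norm_conj, mul_comm]
      exact mul_le_mul_of_nonneg_left (Complex.norm_le_abs_re_add_abs_im z) (norm_nonneg _)
    have h2 : -(y * s.w.im) ≤ |s.w.im| * |y| := by
      rw [← abs_mul, mul_comm]; exact neg_le_abs _
    have h3 : 0 ≤ ‖s.z‖ * (|z.re| + |z.im|) + |s.w.im| * |y| := by positivity
    calc E ≤ (1 + ε) * (‖s.z‖ * (|z.re| + |z.im|) + |s.w.im| * |y|) :=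
          mul_le_mul_of_nonneg_left (by linarith) (by linarith)
      _ ≤ _ := mul_le_mul_of_nonneg_right (by linarith) h3
  have key : ∀ σ τ, (σ, τ) ∈ boxDirs → R * (z * conj σ).re - y * τ * Y ≤ ε + E := by
    intro σ τ h
    have := hp _ h
    simp [boxForm] at this
    simp [hE]
    linarith
  have k1 := key 1 1 (by simp [boxDirs])
  have k2 := key 1 (-1) (by simp [boxDirs])
  have k3 := key (-1) 1 (by simp [boxDirs])
  have k4 := key (-1) (-1) (by simp [boxDirs])
  have k5 := key Complex.I 1 (by simp [boxDirs])
  have k6 := key Complex.I (-1) (by simp [boxDirs])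
  have k7 := key (-Complex.I) 1 (by simp [boxDirs])
  have k8 := key (-Complex.I) (-1) (by simp [boxDirs])
  simp at k1 k2 k3 k4 k5 k6 k7 k8
  have hy : Y * |y| = |y * Y| := by
    rw [abs_mul, abs_of_nonneg (by linarith [abs_nonneg s.w.im] : 0 ≤ Y), mul_comm]
  have hR0 : 0 ≤ R := by linarith [norm_nonneg s.z]
  have hx : R * |z.re| = |R * z.re| := by rw [abs_mul, abs_of_nonneg hR0]
  have hx' : R * |z.im| = |R * z.im| := by rw [abs_mul, abs_of_nonneg hR0]
  have m1 : R * |z.re| + Y * |y| ≤ ε + E := by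
    rw [hx, hy]
    rcases abs_cases (R * z.re) with h | h <;> rcases abs_cases (y * Y) with h' | h' <;> linarith
  have m2 : R * |z.im| + Y * |y| ≤ ε + E := by
    rw [hx', hy]
    rcases abs_cases (R * z.im) with h | h <;> rcases abs_cases (y * Y) with h' | h' <;> linarith
  have m3 := mul_le_mul_of_nonneg_right hR (by positivity : 0 ≤ |z.re| + |z.im|)
  have m4 := mul_le_mul_of_nonneg_right hY (abs_nonneg y)
  have m5 : |z.re| + |z.im| + 2 * |y| ≤ 2 * ε := by linarith
  rw [Prod.norm_def, max_le_iff]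
  constructor
  · exact (Complex.norm_le_abs_re_add_abs_im z).trans (by linarith [abs_nonneg y])
  · rw [Real.norm_eq_abs]; linarith [abs_nonneg z.re, abs_nonneg z.im, abs_nonneg y]

theorem exists_box {s : SUTilde} {t : Ioi (0 : ℝ)} (hs : height s (scale 1 t) = 1)
    {Ω : Set (ℂ × ℝ)} (hΩ : Ω ∈ 𝓝 0) :
    ∃ B ⊆ Ω, B ⊆ tangentDom s t ∧ Convex ℝ B ∧ IsCompact B ∧ ∃ A : Set SUTilde, A.Finite ∧
      (∀ a ∈ A, 1 < height a (scale 1 t)) ∧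
      tangentMap s t '' B = {q | height s q = 1 ∧ ∀ a ∈ A, 1 ≤ height a q} := by
  have ht : (0 : ℝ) < t := t.2
  obtain ⟨hsa, hsr⟩ := abs_arg_lt_of_height_scale_one (hs ▸ zero_lt_one)
  rw [hs] at hsr
  obtain ⟨η, hη, hball⟩ := Metric.mem_nhds_iff.1
    (Filter.inter_mem hΩ ((isOpen_tangentDom s t).mem_nhds (zero_mem_tangentDom s ht)))
  set ε := min 1 (η / 4) with hεd
  have hε : 0 < ε := lt_min one_pos (by positivity)
  have hε1 : ε ≤ 1 := min_le_left _ _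
  have hεη : 2 * ε < η := by have := min_le_right 1 (η / 4); linarith
  set Y := 4 * ‖s.z‖ + 2 * |s.w.im| + 2 with hYd
  have hY1 : 2 ≤ Y := by have := norm_nonneg s.z; have := abs_nonneg s.w.im; linarith
  -- R is dictated by |w|² − |z|² = 1 for the elements `a j` below. Their real part (1 + ε)/t gives
  -- them height 1 + ε at t • 1, so the base point lies strictly inside the box.
  set R := Real.sqrt (((1 + ε) / t) ^ 2 + Y ^ 2 - 1) with hRd
  have hR0 : 0 ≤ ((1 + ε) / (t : ℝ)) ^ 2 + Y ^ 2 - 1 := by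
    have := sq_nonneg ((1 + ε) / (t : ℝ)); nlinarith
  have hR : Y - 1 ≤ R := by
    refine Real.le_sqrt_of_sq_le ?_
    have := sq_nonneg ((1 + ε) / (t : ℝ)); nlinarith
  let a : ℂ × ℝ → SUTilde := fun j => SUTilde.ofPair (R * j.1) ⟨(1 + ε) / t, j.2 * Y⟩
  have haw : ∀ j ∈ boxDirs, (a j).w = ⟨(1 + ε) / t, j.2 * Y⟩ := by
    intro j hj
    refine SUTilde.ofPair_w ?_
    have h1 : ‖j.1‖ = 1 := by
      rcases hj.1 with h | h | h | h <;> rw [h] <;> simp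
    have h2 : j.2 ^ 2 = 1 := by
      rcases hj.2 with h | h <;> rw [h] <;> simp
    rw [norm_mul, h1, mul_one, Complex.norm_real, Real.norm_eq_abs, sq_abs, Real.sq_sqrt hR0,
      ← Complex.normSq_eq_norm_sq, Complex.normSq_mk]
    linear_combination (Y ^ 2) * h2
  have haa : ∀ j, |(a j).arg| < Real.pi / 2 := fun j =>
    Complex.abs_arg_lt_pi_div_two_iff.2 (Or.inl (by simp; positivity))
  let B : Set (ℂ × ℝ) := {p | ∀ j ∈ boxDirs, boxForm s R Y ε j p ≤ ε}
  have hBn : ∀ p ∈ B, ‖p‖ ≤ 2 * ε := fun p hp =>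
    norm_le_of_boxForm_le hε.le hε1 (by linarith [abs_nonneg s.w.im])
      (by linarith [norm_nonneg s.z]) hp
  have hBb : B ⊆ Metric.ball 0 η := fun p hp =>
    mem_ball_zero_iff.2 ((hBn p hp).trans_lt hεη)
  have hBe : B = ⋂ j ∈ boxDirs, {p | boxForm s R Y ε j p ≤ ε} := by ext p; simp [B]
  have hBΩ : B ⊆ tangentDom s t := fun p hp => (hball (hBb hp)).2
  have hequiv : ∀ j ∈ boxDirs, ∀ p : ℂ × ℝ,
      (1 ≤ (a j).w.re * (tangentW s t p).re + p.2 * (a j).w.im - (p.1 * conj (a j).z).re ↔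
        boxForm s R Y ε j p ≤ ε) := by
    intro j hj p
    have e : (a j).w.re * (tangentW s t p).re + p.2 * (a j).w.im - (p.1 * conj (a j).z).re
        = 1 + ε - boxForm s R Y ε j p := by
      have e1 : (a j).w.re * (tangentW s t p).re =
          (1 + ε) * (1 + (p.1 * conj s.z).re - p.2 * s.w.im) := by
        rw [haw j hj]
        change (1 + ε) / t * (t * (1 + (p.1 * conj s.z).re - p.2 * s.w.im)) = _
        field_simp
      rw [e1, haw j hj]
      change _ + p.2 * (j.2 * Y) - (p.1 * conj (R * j.1 : ℂ)).re = 1 + ε -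
        ((p.1 * (R * conj j.1 - (1 + ε) * conj s.z)).re - p.2 * (j.2 * Y - (1 + ε) * s.w.im))
      simp
      ring
    rw [e]
    constructor <;> intro h <;> linarith
  refine ⟨B, fun p hp => (hball (hBb hp)).1, hBΩ, ?_, ?_, a '' boxDirs,
    finite_boxDirs.image a, ?_, ?_⟩
  · rw [hBe]
    exact convex_iInter₂ fun j _ => convex_halfSpace_le (boxForm s R Y ε j).isLinear ε
  · refine (isCompact_closedBall (0 : ℂ × ℝ) (2 * ε)).of_isClosed_subset ?_ fun p hp =>
      mem_closedBall_zero_iff.2 (hBn p hp)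
    rw [hBe]
    exact isClosed_biInter fun j _ =>
      isClosed_le (LinearMap.continuous_of_finiteDimensional _) continuous_const
  · rintro _ ⟨j, hj, rfl⟩
    rw [← tangentMap_zero s ht, height_tangentMap (zero_mem_tangentDom s ht) (haa j), haw j hj]
    refine lt_max_of_lt_right ?_
    simp [tangentW]
    field_simp
    linarith
  · ext q
    constructor
    · rintro ⟨p, hp, rfl⟩
      refine ⟨?_, ?_⟩
      · rw [height_tangentMap_eq hsa hsr.symm (hBΩ hp)]
        simp [tangentForm]
      · rintro _ ⟨j, hj, rfl⟩
        rw [height_tangentMap (hBΩ hp) (haa j)]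
        exact le_max_of_le_right ((hequiv j hj p).2 (hp j hj))
    · rintro ⟨hq, hqa⟩
      set z := (q.t : ℂ) * q.h.z with hz
      set w := (q.t : ℂ) * q.h.w with hw
      have h1 := re_of_height_pos (hq ▸ zero_lt_one)
      rw [hq, ← hz, ← hw] at h1
      have hW : tangentW s t (z, w.im) = w := by
        refine Complex.ext ?_ rfl
        change t * (1 + (z * conj s.z).re - w.im * s.w.im) = w.re
        have : t * s.w.re * w.re = t * (1 + (z * conj s.z).re - w.im * s.w.im) := by
          rw [h1]; simp; ring
        rw [← this, ← hsr, one_mul]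
      have hpB : (z, w.im) ∈ B := by
        intro j hj
        have h2 := hqa _ (mem_image_of_mem a hj)
        rw [re_of_height_pos (zero_lt_one.trans_le h2), ← hz, ← hw] at h2
        rw [← hequiv j hj, hW]
        refine h2.trans_eq ?_
        simp
        ring
      have hre : 0 < w.re := by
        have := re_pos_of_mem_tangentDom (hBΩ hpB)
        rwa [hW] at this
      have hj : ((1, 1) : ℂ × ℝ) ∈ boxDirs := by simp [boxDirs]
      have hcos : 0 < Real.cos q.h.arg := by
        rw [SUTilde.cos_arg_pos_iff]
        rw [hw, Complex.re_ofReal_mul] at hre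
        exact (mul_pos_iff_of_pos_left q.t_pos).1 hre
      -- The pair (z, w) determines q only up to the sheet. Lying in I_a for one of the bounding
      -- elements limits the argument to 3π/2, and the positive cosine does the rest.
      have harg : |q.h.arg| < Real.pi / 2 := by
        refine abs_lt_pi_div_two_of_cos_pos hcos ?_
        have h2 := abs_lt.1 (abs_arg_lt_of_height_pos
          (zero_lt_one.trans_le (hqa _ (mem_image_of_mem a hj))))
        have h3 := abs_lt.1 (SUTilde.abs_mul_arg_sub_lt (a (1, 1)) ((a (1, 1))⁻¹ * q.h))
        have h4 := abs_lt.1 (haa (1, 1))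
        rw [mul_inv_cancel_left] at h3
        rw [abs_lt]
        constructor <;> linarith [h2.1, h2.2, h3.1, h3.2, h4.1, h4.2]
      refine ⟨(z, w.im), hpB, ?_⟩
      rw [tangentMap_of_mem (hBΩ hpB)]
      have hwp : w = q.r * Complex.exp (q.arg * Complex.I) := by rw [hw, ← proj_snd]; rfl
      have hqr : 0 < q.r := (norm_nonneg _).trans_lt q.norm_lt
      ext1
      · exact (proj_fst q).symm
      · change Complex.arg (tangentW s t (z, w.im)) = q.arg
        have h5 := abs_lt.1 harg
        rw [h_arg] at h5
        rw [hW, hwp, Complex.exp_mul_I, Complex.arg_mul_cos_add_sin_mul_I hqr]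
        constructor <;> linarith [h5.1, h5.2, Real.pi_pos]
      · change ‖tangentW s t (z, w.im)‖ = q.r
        rw [hW, hwp, norm_mul, Complex.norm_exp_ofReal_mul_I, mul_one, Complex.norm_real,
          Real.norm_eq_abs, abs_of_pos hqr]

/-- Left translation by the radial projection of q₀ reduces everything to a base point t • 1, where
the affine parametrisation and the box are available. -/
theorem exists_chart {g : SUTilde} {q₀ : LTilde} (hg : height g q₀ = 1) :
    ∃ (Φ : ℂ × ℝ → LTilde) (Ω : Set (ℂ × ℝ)), IsOpen Ω ∧ 0 ∈ Ω ∧ ContinuousOn Φ Ω ∧ Φ 0 = q₀ ∧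
      (∀ p ∈ Ω, height g (Φ p) = 1) ∧
      (∀ g', height g' q₀ = 1 → ∃ l : ℂ × ℝ →ₗ[ℝ] ℝ, (g' ≠ g → l ≠ 0) ∧
        ∀ p ∈ Ω, height g' (Φ p) = max 0 (1 - l p)) ∧
      ∀ Ω' ∈ 𝓝 (0 : ℂ × ℝ), ∃ B ⊆ Ω', B ⊆ Ω ∧ Convex ℝ B ∧ IsCompact B ∧ ∃ A : Set SUTilde,
        A.Finite ∧ (∀ a ∈ A, 1 < height a q₀) ∧
        Φ '' B = {q | height g q = 1 ∧ ∀ a ∈ A, 1 ≤ height a q} := by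
  set h₀ := q₀.h with hh₀
  set t₀ : Ioi (0 : ℝ) := ⟨q₀.t, q₀.t_pos⟩ with ht₀
  have htr : translate h₀ (scale 1 t₀) = q₀ := by
    refine ext_polar ?_ ?_
    · rw [translate_h, scale_h, mul_one]
    · rw [translate_t, scale_t]
  have hheight : ∀ g' q, height g' (translate h₀ q) = height (h₀⁻¹ * g') q := fun g' q => by
    conv_lhs => rw [← mul_inv_cancel_left h₀ g']
    rw [height_translate]
  have hz : ∀ g', height g' q₀ = height (h₀⁻¹ * g') (scale 1 t₀) := fun g' => by
    rw [← hheight, htr]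
  have hs := hg
  rw [hz] at hs
  have hlin : ∀ g', height g' q₀ = 1 → ∀ p ∈ tangentDom (h₀⁻¹ * g) t₀,
      height g' (translate h₀ (tangentMap (h₀⁻¹ * g) t₀ p))
        = max 0 (1 - tangentForm (h₀⁻¹ * g) (h₀⁻¹ * g') p) := by
    intro g' hg' p hp
    rw [hz] at hg'
    obtain ⟨h1, h2⟩ := abs_arg_lt_of_height_scale_one (hg' ▸ zero_lt_one)
    rw [hheight, height_tangentMap_eq h1 (h2.symm.trans hg') hp]
  refine ⟨fun p => translate h₀ (tangentMap (h₀⁻¹ * g) t₀ p), tangentDom (h₀⁻¹ * g) t₀,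
    isOpen_tangentDom _ _, zero_mem_tangentDom _ t₀.2,
    (continuous_translate h₀).comp_continuousOn (continuousOn_tangentMap _ _), ?_, ?_, ?_, ?_⟩
  · simp only
    rw [tangentMap_zero _ t₀.2]
    exact htr
  · intro p hp
    rw [hlin g hg p hp]
    simp [tangentForm]
  · intro g' hg'
    refine ⟨_, fun hne => ?_, hlin g' hg'⟩
    rw [hz] at hg'
    obtain ⟨h1, h2⟩ := abs_arg_lt_of_height_scale_one (hg' ▸ zero_lt_one)
    obtain ⟨h3, h4⟩ := abs_arg_lt_of_height_scale_one (hs ▸ zero_lt_one)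
    refine tangentForm_ne_zero h3 h1 ?_ (by simpa using hne)
    refine mul_left_cancel₀ (ne_of_gt t₀.2) ?_
    rw [← h4, ← h2, hs, hg']
  · intro Ω' hΩ'
    obtain ⟨B, hB, hBd, hBc, hBk, A, hA, hA1, hAB⟩ := exists_box hs hΩ'
    refine ⟨B, hB, hBd, hBc, hBk, (h₀ * ·) '' A, hA.image _, ?_, ?_⟩
    · rintro _ ⟨a, ha, rfl⟩
      rw [hz, inv_mul_cancel_left]
      exact hA1 a ha
    · have himg : (fun p => translate h₀ (tangentMap (h₀⁻¹ * g) t₀ p)) '' B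
          = translate h₀ '' (tangentMap (h₀⁻¹ * g) t₀ '' B) := by rw [image_image]
      rw [himg, hAB]
      ext q
      constructor
      · rintro ⟨q, ⟨hq1, hq2⟩, rfl⟩
        refine ⟨by rw [hheight, hq1], ?_⟩
        rintro _ ⟨a, ha, rfl⟩
        rw [hheight, inv_mul_cancel_left]
        exact hq2 a ha
      · rintro ⟨hq1, hq2⟩
        refine ⟨translate h₀⁻¹ q, ⟨?_, fun a ha => ?_⟩, translate_inv_translate _ _⟩
        · rw [height_translate, hq1]
        · have := hq2 _ (mem_image_of_mem _ ha)
          rwa [← translate_inv_translate h₀ q, hheight, inv_mul_cancel_left] at this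

/-! ### Locally finite unions of intersections of half-spaces -/

/-- The union over `T ∈ 𝓕` of the intersections of the half-spaces `H_g`, `g ∈ T`. -/
def polyOf (𝓕 : Set (Set SUTilde)) : Set LTilde := {q | ∃ T ∈ 𝓕, ∀ g ∈ T, height g q ≤ 1}

/-- Near every point only finitely many of the hypersurfaces `E_g` are relevant for the shape of
`polyOf 𝓕`. -/
def LocFin (𝓕 : Set (Set SUTilde)) : Prop :=
  ∀ q₀ : LTilde, ∃ N ∈ 𝓝 q₀, ∃ S : Set SUTilde, S.Finite ∧ ∀ T ∈ 𝓕, ∀ q ∈ N,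
    (∀ g ∈ T, height g q ≤ 1) → ∀ g ∈ T, g ∉ S → ∀ q' ∈ N, height g q' < 1

/-- The members of `𝓕` all of whose hypersurfaces meeting `N` belong to `S`. -/
def activeSets (𝓕 : Set (Set SUTilde)) (N : Set LTilde) (S : Set SUTilde) : Set (Set SUTilde) :=
  {T ∈ 𝓕 | ∀ g ∈ T, g ∉ S → ∀ q ∈ N, height g q < 1}

/-- After shrinking N, hypersurfaces not passing through q₀ keep their strict side throughout N:
those with height < 1 impose no condition, and those with height > 1 rule T out altogether. Only the
ones through q₀ need to be kept in S. -/
theorem LocFin.refine {𝓕 : Set (Set SUTilde)} (h𝓕 : LocFin 𝓕) (q₀ : LTilde) :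
    ∃ N : Set LTilde, IsOpen N ∧ q₀ ∈ N ∧ ∃ S : Set SUTilde, S.Finite ∧
      (∀ g ∈ S, height g q₀ = 1) ∧
      ∀ T ∈ 𝓕, ∀ q ∈ N, (∀ g ∈ T, height g q ≤ 1) → T ∈ activeSets 𝓕 N S := by
  obtain ⟨N, hN, S, hS, hNS⟩ := h𝓕 q₀
  set M : Set LTilde := interior N ∩ ⋂ g ∈ S, {q | (1 < height g q₀ → 1 < height g q) ∧
    (height g q₀ < 1 → height g q < 1)} with hM
  have hMo : IsOpen M := by
    refine isOpen_interior.inter (hS.isOpen_biInter fun g _ => ?_)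
    refine IsOpen.inter (s := {q | 1 < height g q₀ → 1 < height g q})
      (t := {q | height g q₀ < 1 → height g q < 1}) ?_ ?_
    · by_cases h : 1 < height g q₀
      · simpa [h] using isOpen_lt continuous_const (continuous_height g)
      · simp [h]
    · by_cases h : height g q₀ < 1
      · simpa [h] using isOpen_lt (continuous_height g) continuous_const
      · simp [h]
  refine ⟨M, hMo, ⟨mem_interior_iff_mem_nhds.2 hN, mem_iInter₂.2 fun g _ => ⟨id, id⟩⟩,
    {g ∈ S | height g q₀ = 1}, hS.subset fun g hg => hg.1, fun g hg => hg.2, ?_⟩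
  intro T hT q hq hTq
  refine ⟨hT, fun g hg hgS q' hq' => ?_⟩
  by_cases hgS' : g ∈ S
  · have h1 := mem_iInter₂.1 hq.2 g hgS'
    have h2 := mem_iInter₂.1 hq'.2 g hgS'
    rcases lt_trichotomy (height g q₀) 1 with h | h | h
    · exact h2.2 h
    · exact absurd ⟨hgS', h⟩ hgS
    · exact absurd (hTq g hg) (not_le.2 (h1.1 h))
  · exact hNS T hT q (interior_subset hq.1) hTq g hg hgS' q' (interior_subset hq'.1)

theorem isClosed_polyOf {𝓕 : Set (Set SUTilde)} (h𝓕 : LocFin 𝓕) : IsClosed (polyOf 𝓕) := by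
  rw [← isOpen_compl_iff, isOpen_iff_mem_nhds]
  intro q₀ hq₀
  obtain ⟨N, hNo, hqN, S, hS, hS1, hNS⟩ := h𝓕.refine q₀
  filter_upwards [hNo.mem_nhds hqN] with q hq hqP
  obtain ⟨T, hT, hTq⟩ := hqP
  refine hq₀ ⟨T, hT, fun g hg => ?_⟩
  by_cases hgS : g ∈ S
  · exact (hS1 g hgS).le
  · exact ((hNS T hT q hq hTq).2 g hg hgS q₀ hqN).le

theorem height_scale_lt {g : SUTilde} {q : LTilde} {s : Ioi (0 : ℝ)} (hs : (s : ℝ) < q.t)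
    (hg : height g q ≤ 1) : height g (scale q.h s) < 1 := by
  rw [height_scale]
  rcases (g⁻¹ * q.h).kappa_nonneg.eq_or_lt with h | h
  · rw [← h, mul_zero]; exact zero_lt_one
  · exact lt_of_lt_of_le (mul_lt_mul_of_pos_right hs h) hg

/-- Moving inwards makes every height of the chosen T strictly less than 1, and by local finiteness
finitely many of these inequalities control a whole neighbourhood. This star-shapedness makes ∂P
meet each ray at most once. -/
theorem scale_mem_interior_polyOf {𝓕 : Set (Set SUTilde)} (h𝓕 : LocFin 𝓕) {q : LTilde}
    (hq : q ∈ polyOf 𝓕) {s : Ioi (0 : ℝ)} (hs : (s : ℝ) < q.t) :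
    scale q.h s ∈ interior (polyOf 𝓕) := by
  obtain ⟨T, hT, hTq⟩ := hq
  obtain ⟨N, hNo, hqN, S, hS, hS1, hNS⟩ := h𝓕.refine (scale q.h s)
  have hlt : ∀ g ∈ T, height g (scale q.h s) < 1 := fun g hg => height_scale_lt hs (hTq g hg)
  refine mem_interior.2 ⟨N, fun q' hq' => ⟨T, hT, fun g hg => ?_⟩, hNo, hqN⟩
  refine ((hNS T hT _ hqN fun g hg => (hlt g hg).le).2 g hg (fun hgS => ?_) q' hq').le
  exact (hlt g hg).ne (hS1 g hgS)

theorem exists_scale_subset {q : LTilde} {N : Set LTilde} (hN : N ∈ 𝓝 q) :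
    ∃ W ∈ 𝓝 q.h, ∃ ε > 0, ε < q.t ∧
      ∀ h ∈ W, ∀ s : Ioi (0 : ℝ), |(s : ℝ) - q.t| < ε → scale h s ∈ N := by
  have h1 : Filter.Tendsto (fun p : SUTilde × Ioi (0 : ℝ) => scale p.1 p.2)
      (𝓝 (q.h, ⟨q.t, q.t_pos⟩)) (𝓝 q) := by
    have := continuous_scale.tendsto (q.h, ⟨q.t, q.t_pos⟩)
    rwa [scale_h_t] at this
  obtain ⟨W, hW, V, hV, hWV⟩ := mem_nhds_prod_iff.1 (h1 hN)
  obtain ⟨ε, hε, hs⟩ := Metric.mem_nhds_iff.1 hV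
  refine ⟨W, hW, min ε (q.t / 2), lt_min hε (half_pos q.t_pos),
    (min_le_right _ _).trans_lt (half_lt_self q.t_pos), fun h hh s hs' => ?_⟩
  refine mem_preimage.1 (hWV (mk_mem_prod hh (hs ?_)))
  exact hs'.trans_le (min_le_left _ _)

theorem exists_mem_frontier_of_isPreconnected {X : Type*} [TopologicalSpace X] {s P : Set X}
    (hs : IsPreconnected s) (hP : IsClosed P) (h1 : (s ∩ interior P).Nonempty)
    (h2 : (s ∩ Pᶜ).Nonempty) : ∃ x ∈ s, x ∈ frontier P := by
  by_contra! hcon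
  obtain ⟨x, _, hx, hx'⟩ := hs _ _ isOpen_interior hP.isOpen_compl (fun x hx => by
    by_cases hxP : x ∈ P
    · left
      by_contra hxi
      exact hcon x hx (hP.frontier_eq ▸ ⟨hxP, hxi⟩)
    · exact Or.inr hxP) h1 h2
  exact hx' (interior_subset hx)

/-- If the boundary of `polyOf 𝓕` is contained in `E_g` near `q`, then it agrees with `E_g`
near `q`. -/
theorem mem_frontier_of_height_eq_one {𝓕 : Set (Set SUTilde)} (h𝓕 : LocFin 𝓕) {g : SUTilde}
    {q : LTilde} (hq : q ∈ frontier (polyOf 𝓕)) {V : Set LTilde} (hV : V ∈ 𝓝 q)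
    (hVg : V ∩ frontier (polyOf 𝓕) ⊆ {q | height g q = 1}) :
    ∃ V' ∈ 𝓝 q, ∀ q' ∈ V', height g q' = 1 → q' ∈ frontier (polyOf 𝓕) := by
  have hcl := isClosed_polyOf h𝓕
  have hqP : q ∈ polyOf 𝓕 := hcl.frontier_subset hq
  obtain ⟨W, hW, ε, hε, hεt, hWV⟩ := exists_scale_subset hV
  set s₁ : Ioi (0 : ℝ) := ⟨q.t - ε / 2, by change 0 < q.t - ε / 2; linarith⟩ with hs₁
  set s₂ : Ioi (0 : ℝ) := ⟨q.t + ε / 2, by change 0 < q.t + ε / 2; linarith⟩ with hs₂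
  have h1 : scale q.h s₁ ∈ interior (polyOf 𝓕) :=
    scale_mem_interior_polyOf h𝓕 hqP (by change q.t - ε / 2 < q.t; linarith)
  have h2 : scale q.h s₂ ∈ (polyOf 𝓕)ᶜ := by
    intro hcon
    have h3 := scale_mem_interior_polyOf h𝓕 hcon (s := ⟨q.t, q.t_pos⟩)
      (by rw [scale_t]; change q.t < q.t + ε / 2; linarith)
    rw [scale_h, scale_h_t] at h3
    exact hq.2 h3
  have hc : ∀ s, Continuous fun q' : LTilde => scale q'.h s := fun s =>
    continuous_scale.comp (continuous_h.prodMk continuous_const)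
  have e1 : ∀ᶠ q' in 𝓝 q, scale q'.h s₁ ∈ interior (polyOf 𝓕) :=
    (hc s₁).continuousAt.eventually_mem (isOpen_interior.mem_nhds h1)
  have e2 : ∀ᶠ q' in 𝓝 q, scale q'.h s₂ ∈ (polyOf 𝓕)ᶜ :=
    (hc s₂).continuousAt.eventually_mem (hcl.isOpen_compl.mem_nhds h2)
  have e3 : ∀ᶠ q' in 𝓝 q, q'.h ∈ W := continuous_h.continuousAt.eventually_mem hW
  refine ⟨_, (e1.and (e2.and e3)), fun q' hq' hgq' => ?_⟩
  obtain ⟨hq1, hq2, hq3⟩ := hq'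
  -- The maximum only guarantees positivity; on the interval used below it is the identity.
  let c : ℝ → Ioi (0 : ℝ) := fun x => ⟨max x (q.t - ε / 2), mem_Ioi.2 (lt_max_of_lt_right (mem_Ioi.1 s₁.2))⟩
  have hcont : Continuous fun x => scale q'.h (c x) :=
    (continuous_scale_right _).comp (Continuous.subtype_mk (by fun_prop) _)
  have hle : q.t - ε / 2 ≤ q.t + ε / 2 := by linarith
  have hc1 : c (q.t - ε / 2) = s₁ := Subtype.ext (max_self _)
  have hc2 : c (q.t + ε / 2) = s₂ := Subtype.ext (max_eq_left hle)
  -- A ray near that of q still runs from the interior of P to its complement, so it crosses ∂P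
  -- inside V, hence on E_g. The height is linear in t along the ray, so the crossing point can only
  -- be q'.
  obtain ⟨_, ⟨x, hs, rfl⟩, hx⟩ := exists_mem_frontier_of_isPreconnected
    ((isPreconnected_Icc (a := q.t - ε / 2) (b := q.t + ε / 2)).image _ hcont.continuousOn) hcl
    ⟨_, mem_image_of_mem _ (left_mem_Icc.2 hle), by rw [hc1]; exact hq1⟩
    ⟨_, mem_image_of_mem _ (right_mem_Icc.2 hle), by rw [hc2]; exact hq2⟩
  set s := c x
  have hsx : (s : ℝ) = x := max_eq_left hs.1
  have hsl : q.t - ε / 2 ≤ s := hsx ▸ hs.1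
  have hsr : (s : ℝ) ≤ q.t + ε / 2 := hsx ▸ hs.2
  have hg1 : height g (scale q'.h s) = 1 :=
    hVg ⟨hWV _ hq3 s (by rw [abs_lt]; constructor <;> linarith), hx⟩
  have hst : (s : ℝ) = q'.t := by
    rw [height_scale] at hg1
    rw [height] at hgq'
    refine mul_right_cancel₀ (b := (g⁻¹ * q'.h).kappa) (fun h0 => ?_) (hg1.trans hgq'.symm)
    rw [h0, mul_zero] at hg1
    exact zero_ne_one hg1
  have : scale q'.h s = q' := ext_polar (scale_h _ _) ((scale_t _ _).trans hst)
  change scale q'.h s ∈ _ at hx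
  rwa [this] at hx

/-! ### Faces and their generic points -/

/-- The points of the boundary of `P` near which this boundary is contained in `E_g`. -/
def faceCore (P : Set LTilde) (g : SUTilde) : Set LTilde :=
  {q ∈ frontier P | ∃ V ∈ 𝓝 q, V ∩ frontier P ⊆ {q | height g q = 1}}

theorem image_closure_interior_eq (P : Set LTilde) (g : SUTilde) :
    Subtype.val '' closure (interior {q : frontier P | (q : LTilde) ∈ frontier (halfH g)})
      = closure (faceCore P g) := by
  rw [← isClosed_frontier.isClosedEmbedding_subtypeVal.closure_image_eq]
  congr 1
  ext q
  rw [frontier_halfH]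
  constructor
  · rintro ⟨q, hq, rfl⟩
    refine ⟨q.2, ?_⟩
    obtain ⟨V, hV, hVs⟩ := mem_nhds_subtype _ _ _ |>.1 (mem_interior_iff_mem_nhds.1 hq)
    exact ⟨V, hV, fun q' hq' => hVs (show (⟨q', hq'.2⟩ : frontier P) ∈ Subtype.val ⁻¹' V from hq'.1)⟩
  · rintro ⟨hq, V, hV, hVs⟩
    refine ⟨⟨q, hq⟩, mem_interior_iff_mem_nhds.2 ?_, rfl⟩
    exact (mem_nhds_subtype _ _ _).2 ⟨V, hV, fun q' hq' => hVs ⟨hq', q'.2⟩⟩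

theorem mem_faceCore_of_local {P : Set LTilde} {g : SUTilde} {q : LTilde} (hq : height g q = 1)
    {V : Set LTilde} (hV : V ∈ 𝓝 q) (hVP : ∀ q' ∈ V, q' ∈ P ↔ height g q' ≤ 1) :
    q ∈ faceCore P g := by
  obtain ⟨U, hUV, hU, hqU⟩ := mem_nhds_iff.1 hV
  have h1 : P ∩ U = halfH g ∩ U := by
    ext q'
    rw [halfH_eq]
    exact and_congr_left fun h => hVP q' (hUV h)
  have h2 : frontier P ∩ U = frontier (halfH g) ∩ U := by
    rw [← frontier_inter_open_inter hU, h1, frontier_inter_open_inter hU]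
  rw [frontier_halfH] at h2
  refine ⟨(h2.superset ⟨hq, hqU⟩).1, U, hU.mem_nhds hqU, fun q' hq' => ?_⟩
  exact (h2.subset ⟨hq'.2, hq'.1⟩).1

/-- The set `T` determines a piece of `polyOf 𝓕` near `q`, apart from the condition given by the
half-space `H_g`. -/
def IsNear (𝓕 : Set (Set SUTilde)) (N : Set LTilde) (S : Set SUTilde) (g : SUTilde) (q : LTilde)
    (T : Set SUTilde) : Prop :=
  T ∈ activeSets 𝓕 N S ∧ ∀ h ∈ T, h ∈ S → h ≠ g → height h q ≤ 1

theorem eventually_same_side {S : Set SUTilde} (hS : S.Finite) (q : LTilde) :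
    ∀ᶠ q' in 𝓝 q, ∀ h ∈ S, (height h q < 1 → height h q' < 1) ∧
      (1 < height h q → 1 < height h q') := by
  refine (hS.eventually_all).2 fun h _ => ?_
  have hc := (continuous_height h).continuousAt (x := q)
  refine Filter.Eventually.and ?_ ?_
  · by_cases h1 : height h q < 1
    · filter_upwards [hc.eventually_lt_const h1] with q' hq' _ using hq'
    · exact Filter.Eventually.of_forall fun q' h2 => absurd h2 h1
  · by_cases h1 : 1 < height h q
    · filter_upwards [hc.eventually_const_lt h1] with q' hq' _ using hq'
    · exact Filter.Eventually.of_forall fun q' h2 => absurd h2 h1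

section Generic

variable {𝓕 : Set (Set SUTilde)} {N : Set LTilde} {S : Set SUTilde} {g : SUTilde}

/-- Points of P close to q supply a near T. If some near T omitted g, all its relevant inequalities
would be strict at the generic point q, and q would be interior to P. -/
theorem exists_isNear (hN : IsOpen N) (hS : S.Finite)
    (hNS : ∀ T ∈ 𝓕, ∀ q ∈ N, (∀ g ∈ T, height g q ≤ 1) → T ∈ activeSets 𝓕 N S)
    {q : LTilde} (hq : q ∈ N) (hgen : ∀ h ∈ S, h ≠ g → height h q ≠ 1)
    (hfr : q ∈ frontier (polyOf 𝓕)) :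
    (∃ T, IsNear 𝓕 N S g q T) ∧ ∀ T, IsNear 𝓕 N S g q T → g ∈ T := by
  have hev := (hN.mem_nhds hq)
  constructor
  · obtain ⟨q', ⟨hq', hside⟩, T, hT, hTq⟩ := mem_closure_iff_nhds.1
      (frontier_subset_closure hfr) _ (Filter.inter_mem hev (eventually_same_side hS q))
    refine ⟨T, hNS T hT q' hq' hTq, fun h hh hhS _ => ?_⟩
    exact not_lt.1 fun hlt => (hTq h hh).not_gt ((hside h hhS).2 hlt)
  · intro T hT
    by_contra hgT
    refine hfr.2 (mem_interior_iff_mem_nhds.2 ?_)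
    filter_upwards [hev, eventually_same_side hS q] with q' hq' hside
    refine ⟨T, hT.1.1, fun h hh => ?_⟩
    by_cases hhS : h ∈ S
    · have hne : h ≠ g := fun e => hgT (e ▸ hh)
      exact ((hside h hhS).1 (lt_of_le_of_ne (hT.2 h hh hhS hne) (hgen h hhS hne))).le
    · exact (hT.1.2 h hh hhS q' hq').le

/-- A converse to `exists_isNear`: around q every T that can be satisfied contains g, and one near T
imposes nothing besides H_g, so P coincides with H_g there. -/
theorem mem_faceCore_of_isNear (hN : IsOpen N) (hS : S.Finite)
    (hNS : ∀ T ∈ 𝓕, ∀ q ∈ N, (∀ g ∈ T, height g q ≤ 1) → T ∈ activeSets 𝓕 N S)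
    {q : LTilde} (hq : q ∈ N) (hgq : height g q = 1) (hgen : ∀ h ∈ S, h ≠ g → height h q ≠ 1)
    (h1 : ∃ T, IsNear 𝓕 N S g q T) (h2 : ∀ T, IsNear 𝓕 N S g q T → g ∈ T) :
    q ∈ faceCore (polyOf 𝓕) g := by
  refine mem_faceCore_of_local hgq
    (Filter.inter_mem (hN.mem_nhds hq) (eventually_same_side hS q)) ?_
  rintro q' ⟨hq', hside⟩
  constructor
  · rintro ⟨T, hT, hTq⟩
    refine hTq g (h2 T ⟨hNS T hT q' hq' hTq, fun h hh hhS _ => ?_⟩)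
    exact not_lt.1 fun hlt => (hTq h hh).not_gt ((hside h hhS).2 hlt)
  · intro hg
    obtain ⟨T, hT⟩ := h1
    refine ⟨T, hT.1.1, fun h hh => ?_⟩
    by_cases hhS : h ∈ S
    · by_cases hne : h = g
      · rw [hne]; exact hg
      · exact ((hside h hhS).1 (lt_of_le_of_ne (hT.2 h hh hhS hne) (hgen h hhS hne))).le
    · exact (hT.1.2 h hh hhS q' hq').le

end Generic

theorem dense_linearMap_ne_zero {l : ℂ × ℝ →ₗ[ℝ] ℝ} (hl : l ≠ 0) : Dense {p | l p ≠ 0} := by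
  have h1 : {p | l p ≠ 0} = (l.ker : Set (ℂ × ℝ))ᶜ := by ext p; simp
  rw [h1, ← interior_eq_empty_iff_dense_compl]
  by_contra hne
  have := Submodule.eq_top_of_nonempty_interior' l.ker (nonempty_iff_ne_empty.2 hne)
  exact hl (LinearMap.ker_eq_top.1 this)

theorem exists_forall_linearMap_ne_zero {ι : Type*} {S : Set ι} (hS : S.Finite)
    {l : ι → ℂ × ℝ →ₗ[ℝ] ℝ} (hl : ∀ i ∈ S, l i ≠ 0) {O : Set (ℂ × ℝ)} {p : ℂ × ℝ}
    (hO : O ∈ 𝓝 p) : ∃ p' ∈ O, ∀ i ∈ S, l i p' ≠ 0 := by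
  have hd : Dense (⋂ i ∈ S, {p | l i p ≠ 0}) := by
    refine dense_biInter_of_isOpen (fun i _ => ?_) hS.countable
      fun i hi => dense_linearMap_ne_zero (hl i hi)
    exact isOpen_ne_fun (LinearMap.continuous_of_finiteDimensional _) continuous_const
  obtain ⟨p', hp', hp''⟩ := mem_closure_iff_nhds.1 (hd p) O hO
  exact ⟨p', hp', fun i hi => mem_iInter₂.1 hp'' i hi⟩

theorem max_one_sub_lt_one_iff {x : ℝ} : max 0 (1 - x) < 1 ↔ 0 < x := by
  rw [max_lt_iff]; constructor
  · intro h; linarith [h.2]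
  · intro h; exact ⟨one_pos, by linarith⟩

theorem one_lt_max_one_sub_iff {x : ℝ} : 1 < max 0 (1 - x) ↔ x < 0 := by
  rw [lt_max_iff]; constructor
  · rintro (h | h) <;> linarith
  · intro h; right; linarith

/-! ### Local cell structure of a face -/

/-- A compact set which is a finite intersection of half-spaces. -/
def IsCompactCell (C : Set LTilde) : Prop :=
  IsCompact C ∧ ∃ 𝓢 : Set (Set LTilde), 𝓢.Finite ∧ (∀ X ∈ 𝓢, IsHalfSpace X) ∧ C = ⋂₀ 𝓢

theorem isCompactCell_of_eq {C : Set LTilde} (hC : IsCompact C) {A A' : Set SUTilde}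
    (hA : A.Finite) (hA' : A'.Finite)
    (h : C = {q | (∀ a ∈ A, 1 ≤ height a q) ∧ ∀ a ∈ A', height a q ≤ 1}) : IsCompactCell C := by
  refine ⟨hC, halfI '' A ∪ halfH '' A', (hA.image _).union (hA'.image _), ?_, ?_⟩
  · rintro _ (⟨a, _, rfl⟩ | ⟨a, _, rfl⟩)
    · exact ⟨a, Or.inl rfl⟩
    · exact ⟨a, Or.inr rfl⟩
  · rw [h]
    ext q
    simp only [sInter_union, sInter_image, mem_inter_iff, mem_iInter, halfI_eq, halfH_eq]
    rfl

/-- Near each of its points a face of `polyOf 𝓕` is a finite union of compact cells. -/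
theorem exists_local_cells {𝓕 : Set (Set SUTilde)} (h𝓕 : LocFin 𝓕) {g : SUTilde} {q₀ : LTilde}
    (hq₀ : q₀ ∈ closure (faceCore (polyOf 𝓕) g)) :
    q₀ ∈ closure {q | ∃ T ∈ 𝓕, g ∈ T ∧ ∀ h ∈ T, height h q ≤ 1} ∧
      ∃ M ∈ 𝓝 q₀, ∃ 𝒞 : Set (Set LTilde), 𝒞.Finite ∧ (∀ C ∈ 𝒞, IsCompactCell C) ∧
        closure (faceCore (polyOf 𝓕) g) ∩ M ⊆ ⋃₀ 𝒞 ∧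
        ⋃₀ 𝒞 ⊆ closure (faceCore (polyOf 𝓕) g) := by
  set F := closure (faceCore (polyOf 𝓕) g) with hF
  have hcore1 : ∀ q ∈ faceCore (polyOf 𝓕) g, height g q = 1 := by
    rintro q ⟨hq, V, hV, hVs⟩
    exact hVs ⟨mem_of_mem_nhds hV, hq⟩
  have hg : height g q₀ = 1 :=
    closure_minimal hcore1 (isClosed_eq (continuous_height g) continuous_const) hq₀
  obtain ⟨N, hN, hqN, S, hS, hS1, hNS⟩ := h𝓕.refine q₀
  obtain ⟨Φ, Ω, hΩ, h0Ω, hΦc, hΦ0, hΦg, hΦl, hbox⟩ := exists_chart hg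
  have hΩ' : Ω ∩ Φ ⁻¹' N ∈ 𝓝 0 := (hΦc.isOpen_inter_preimage hΩ hN).mem_nhds
    ⟨h0Ω, by rw [mem_preimage, hΦ0]; exact hqN⟩
  obtain ⟨B, hBΩ', hBΩ, hBconv, hBcomp, A, hA, hA1, hΦB⟩ := hbox _ hΩ'
  set S' := S \ {g} with hS'
  have hS'f : S'.Finite := hS.sdiff
  choose! l hl0 hl using fun g' (hg' : g' ∈ S) => hΦl g' (hS1 g' hg')
  -- Generic boundary points in the box lie on no relevant hypersurface except E_g. `σ q` is the
  -- sign pattern of q and `cell (σ q)` the closed cell of the arrangement with that pattern; only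
  -- patterns of points of `gen` will be used.
  let gen : Set LTilde := {q | q ∈ Φ '' B ∧ q ∈ frontier (polyOf 𝓕) ∧
    ∀ h ∈ S, h ≠ g → height h q ≠ 1}
  let σ : LTilde → Set SUTilde := fun q => {h ∈ S' | height h q ≤ 1}
  let cell : Set SUTilde → Set LTilde := fun s =>
    {q ∈ Φ '' B | (∀ h ∈ s, height h q ≤ 1) ∧ ∀ h ∈ S' \ s, 1 ≤ height h q}
  have hΦBcomp : IsCompact (Φ '' B) := hBcomp.image_of_continuousOn (hΦc.mono hBΩ)
  have hcellcl : ∀ s, IsClosed {q | (∀ h ∈ s, height h q ≤ 1) ∧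
      ∀ h ∈ S' \ s, 1 ≤ height h q} := fun s => by
    have e : {q : LTilde | (∀ h ∈ s, height h q ≤ 1) ∧ ∀ h ∈ S' \ s, 1 ≤ height h q} =
        (⋂ h ∈ s, {q | height h q ≤ 1}) ∩ ⋂ h ∈ S' \ s, {q | 1 ≤ height h q} := by
      ext q; simp
    rw [e]
    exact (isClosed_biInter fun h _ => isClosed_le (continuous_height h) continuous_const).inter
      (isClosed_biInter fun h _ => isClosed_le continuous_const (continuous_height h))
  have hcellcomp : ∀ s, IsCompact (cell s) := fun s => hΦBcomp.inter_right (hcellcl s)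
  let 𝒞 : Set (Set LTilde) := (fun q => cell (σ q)) '' gen
  have h𝒞f : 𝒞.Finite := by
    have : 𝒞 ⊆ cell '' (𝒫 S') := by
      rintro _ ⟨q, _, rfl⟩
      exact mem_image_of_mem _ fun h hh => hh.1
    exact (hS'f.powerset.image _).subset this
  have hBN : ∀ p ∈ B, Φ p ∈ N := fun p hp => (hBΩ' hp).2
  -- A generic boundary point satisfies all conditions of a T containing g. This yields the first
  -- conclusion, which the compactness proof needs.
  have hgenT : gen ⊆ {q | ∃ T ∈ 𝓕, g ∈ T ∧ ∀ h ∈ T, height h q ≤ 1} := by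
    rintro _ ⟨⟨p, hp, rfl⟩, hfr, hgen⟩
    obtain ⟨⟨T, hT⟩, hgT⟩ := exists_isNear hN hS hNS (hBN p hp) hgen hfr
    refine ⟨T, hT.1.1, hgT T hT, fun h hh => ?_⟩
    by_cases hhS : h ∈ S
    · by_cases hne : h = g
      · rw [hne]; exact (hΦg p (hBΩ hp)).le
      · exact hT.2 h hh hhS hne
    · exact (hT.1.2 h hh hhS _ (hBN p hp)).le
  have hgen𝒞 : gen ⊆ ⋃₀ 𝒞 := by
    intro q hq
    refine ⟨_, mem_image_of_mem _ hq, hq.1, fun h hh => hh.2, fun h hh => ?_⟩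
    exact (not_le.1 fun hle => hh.2 ⟨hh.1, hle⟩).le
  set M : Set LTilde := ⋂ a ∈ A, {q | 1 < height a q} with hM
  have hMo : IsOpen M :=
    hA.isOpen_biInter fun a _ => isOpen_lt continuous_const (continuous_height a)
  have hqM : q₀ ∈ M := mem_iInter₂.2 hA1
  have hMB : ∀ q ∈ M, height g q = 1 → q ∈ Φ '' B := fun q hq hgq => by
    rw [hΦB]
    exact ⟨hgq, fun a ha => (mem_iInter₂.1 hq a ha).le⟩
  -- Near a core point E_g is contained in ∂P, and in the chart the other hypersurfaces are zero
  -- sets of non-zero linear forms, hence nowhere dense.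
  have hcoregen : faceCore (polyOf 𝓕) g ∩ M ⊆ closure gen := by
    rintro q ⟨hqc, hqM⟩
    obtain ⟨p, hp, rfl⟩ := hMB q hqM (hcore1 q hqc)
    obtain ⟨V, hV, hVs⟩ := hqc.2
    obtain ⟨V', hV', hVfr⟩ := mem_frontier_of_height_eq_one h𝓕 hqc.1 hV hVs
    rw [mem_closure_iff_nhds]
    intro W hW
    have hpre : Ω ∩ Φ ⁻¹' (W ∩ V' ∩ M) ∈ 𝓝 p :=
      Filter.inter_mem (hΩ.mem_nhds (hBΩ hp))
        ((hΦc.continuousAt (hΩ.mem_nhds (hBΩ hp))).preimage_mem_nhds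
          (Filter.inter_mem (Filter.inter_mem hW hV') (hMo.mem_nhds hqM)))
    obtain ⟨p', ⟨hp'Ω, ⟨hp'W, hp'V⟩, hp'M⟩, hp'l⟩ :=
      exists_forall_linearMap_ne_zero (S := S') (l := l) hS'f
        (fun i hi => hl0 i hi.1 hi.2) hpre
    refine ⟨Φ p', hp'W, hMB _ hp'M (hΦg p' hp'Ω), hVfr _ hp'V (hΦg p' hp'Ω), ?_⟩
    intro h hh hne heq
    rw [hl h hh p' hp'Ω] at heq
    rcases lt_trichotomy (l h p') 0 with hlt | hlt | hlt
    · exact (one_lt_max_one_sub_iff.2 hlt).ne' heq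
    · exact hp'l h ⟨hh, hne⟩ hlt
    · exact (max_one_sub_lt_one_iff.2 hlt).ne heq
  have hFgen : F ∩ M ⊆ closure gen := by
    rintro q ⟨hqF, hqM⟩
    rw [← closure_closure]
    refine closure_mono hcoregen ?_
    exact mem_closure_iff_nhds.2 fun W hW => by
      obtain ⟨x, hx⟩ := mem_closure_iff_nhds.1 hqF _ (Filter.inter_mem hW (hMo.mem_nhds hqM))
      exact ⟨x, hx.1.1, hx.2, hx.1.2⟩
  refine ⟨closure_mono hgenT (hFgen ⟨hq₀, hqM⟩), M, hMo.mem_nhds hqM, 𝒞, h𝒞f, ?_, ?_, ?_⟩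
  · rintro _ ⟨q, hq, rfl⟩
    -- g enters both lists because E_g = I_g ∩ H_g.
    refine isCompactCell_of_eq (A := insert g A ∪ (S' \ σ q)) (A' := insert g (σ q)) (hcellcomp _)
      ((hA.insert _).union hS'f.sdiff) ((hS'f.subset fun h hh => hh.1).insert _) ?_
    ext x
    change x ∈ Φ '' B ∧ _ ↔ _
    rw [hΦB]
    constructor
    · rintro ⟨⟨h1, h2⟩, h3, h4⟩
      refine ⟨?_, ?_⟩
      · rintro a ((rfl | ha) | ha)
        · exact h1.ge
        · exact h2 a ha
        · exact h4 a ha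
      · rintro a (rfl | ha)
        · exact h1.le
        · exact h3 a ha
    · rintro ⟨h1, h2⟩
      exact ⟨⟨le_antisymm (h2 g (mem_insert _ _)) (h1 g (Or.inl (mem_insert _ _))),
        fun a ha => h1 a (Or.inl (Or.inr ha))⟩, fun a ha => h2 a (Or.inr ha),
        fun a ha => h1 a (Or.inr ha)⟩
  · refine hFgen.trans (closure_minimal hgen𝒞 ?_)
    exact (h𝒞f.isCompact_sUnion fun C hC => by
      obtain ⟨q, _, rfl⟩ := hC; exact hcellcomp _).isClosed
  · rintro _ ⟨_, ⟨_, ⟨⟨p, hp, rfl⟩, hfr, hgen⟩, rfl⟩, ⟨p₁, hp₁, rfl⟩, hs1, hs2⟩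
    obtain ⟨hT, hgT⟩ := exists_isNear hN hS hNS (hBN p hp) hgen hfr
    -- On the segment from an arbitrary point p₁ of the cell to the generic point p, every parameter
    -- x > 0 has the strict signs of p. These points are thus in the core, and x → 0 puts Φ p₁ in
    -- its closure.
    let c : ℝ → ℂ × ℝ := fun x => (1 - x) • p₁ + x • p
    have hc : Continuous c := by fun_prop
    have hcB : ∀ x ∈ Icc (0 : ℝ) 1, c x ∈ B := fun x hx =>
      hBconv hp₁ hp (by linarith [hx.2]) hx.1 (by ring)
    have hlc : ∀ h x, l h (c x) = (1 - x) * l h p₁ + x * l h p := fun h x => by simp [c]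
    have hside : ∀ x ∈ Ioc (0 : ℝ) 1, ∀ h ∈ S, h ≠ g →
        height h (Φ (c x)) ≠ 1 ∧ (height h (Φ (c x)) ≤ 1 ↔ height h (Φ p) ≤ 1) := by
      intro x hx h hh hne
      have hcx := hBΩ (hcB x ⟨hx.1.le, hx.2⟩)
      rcases lt_or_gt_of_ne (hgen h hh hne) with hlt | hlt
      · have h1 := hs1 h ⟨⟨hh, hne⟩, hlt.le⟩
        have h2 := hlt
        rw [hl h hh p (hBΩ hp), max_one_sub_lt_one_iff] at h2
        rw [hl h hh p₁ (hBΩ hp₁), ← not_lt, one_lt_max_one_sub_iff, not_lt] at h1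
        have h3 : height h (Φ (c x)) < 1 := by
          rw [hl h hh _ hcx, max_one_sub_lt_one_iff, hlc]
          have := mul_nonneg (by linarith [hx.2] : 0 ≤ 1 - x) h1
          have := mul_pos hx.1 h2
          linarith
        exact ⟨h3.ne, iff_of_true h3.le hlt.le⟩
      · have h1 := hs2 h ⟨⟨hh, hne⟩, fun hcon => hcon.2.not_gt hlt⟩
        have h2 := hlt
        rw [hl h hh p (hBΩ hp), one_lt_max_one_sub_iff] at h2
        rw [hl h hh p₁ (hBΩ hp₁), ← not_lt, max_one_sub_lt_one_iff, not_lt] at h1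
        have h3 : 1 < height h (Φ (c x)) := by
          rw [hl h hh _ hcx, one_lt_max_one_sub_iff, hlc]
          have := mul_nonneg (by linarith [hx.2] : 0 ≤ 1 - x) (neg_nonneg.2 h1)
          have := mul_pos hx.1 (neg_pos.2 h2)
          linarith
        exact ⟨h3.ne', iff_of_false h3.not_ge hlt.not_ge⟩
    have hmem : ∀ x ∈ Ioc (0 : ℝ) 1, Φ (c x) ∈ faceCore (polyOf 𝓕) g := by
      intro x hx
      have hx' : x ∈ Icc (0 : ℝ) 1 := ⟨hx.1.le, hx.2⟩
      have hiff : ∀ T, IsNear 𝓕 N S g (Φ (c x)) T ↔ IsNear 𝓕 N S g (Φ p) T := fun T =>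
        and_congr_right fun _ => forall₄_congr fun h _ hhS hne => (hside x hx h hhS hne).2
      refine mem_faceCore_of_isNear hN hS hNS (hBN _ (hcB x hx')) (hΦg _ (hBΩ (hcB x hx')))
        (fun h hh hne => (hside x hx h hh hne).1) ?_ ?_
      · simpa only [hiff] using hT
      · simpa only [hiff] using hgT
    have hΦcc : ContinuousOn (fun x => Φ (c x)) (Icc 0 1) :=
      (hΦc.mono hBΩ).comp hc.continuousOn hcB
    have hcl : (0 : ℝ) ∈ closure (Ioc (0 : ℝ) 1) := by
      rw [closure_Ioc zero_ne_one]; exact ⟨le_rfl, zero_le_one⟩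
    have h0 : Φ (c 0) = Φ p₁ := by simp [c]
    rw [← h0]
    have hw : ContinuousWithinAt (fun x => Φ (c x)) (Ioc 0 1) 0 :=
      (hΦcc 0 ⟨le_rfl, zero_le_one⟩).mono Ioc_subset_Icc_self
    exact hw.mem_closure hcl hmem

end LTilde

/-! ### Rotations, the centre and isotropy groups -/

namespace SUTilde

/-- The lift of the rotation of the disc around `0` by the angle `-2θ`. -/
def rho (θ : ℝ) : SUTilde := ⟨0, θ⟩

theorem rho_w (θ : ℝ) : (rho θ).w = Complex.exp (θ * Complex.I) := by
  have : (rho θ).r = 1 := by rw [r, rho]; simp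
  rw [w, this, Complex.ofReal_one, one_mul]; rfl

theorem rho_mul_z (θ : ℝ) (g : SUTilde) :
    (rho θ * g).z = Complex.exp (-(θ * Complex.I)) * g.z := by
  rw [mul_z, rho_w, ← Complex.exp_conj]
  simp [rho]

theorem rho_mul_arg (θ : ℝ) (g : SUTilde) : (rho θ * g).arg = θ + g.arg := by
  rw [mul_arg]; simp [rho]

theorem mul_rho_z (θ : ℝ) (g : SUTilde) :
    (g * rho θ).z = Complex.exp (θ * Complex.I) * g.z := by
  rw [mul_z, rho_w]
  simp [rho, mul_comm]

theorem mul_rho_arg (θ : ℝ) (g : SUTilde) : (g * rho θ).arg = g.arg + θ := by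
  rw [mul_arg]; simp [rho]

theorem rho_mul_r (θ : ℝ) (g : SUTilde) : (rho θ * g).r = g.r := by
  rw [r, rho_mul_z, norm_mul, r, ← neg_mul, ← Complex.ofReal_neg,
    Complex.norm_exp_ofReal_mul_I, one_mul]

theorem rho_add (θ η : ℝ) : rho (θ + η) = rho θ * rho η := by
  ext1
  · rw [rho_mul_z]; simp [rho]
  · rw [rho_mul_arg]; rfl

theorem rho_zero : rho 0 = 1 := rfl

theorem rho_neg (θ : ℝ) : rho (-θ) = (rho θ)⁻¹ := by
  rw [eq_inv_iff_mul_eq_one, ← rho_add, neg_add_cancel, rho_zero]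

theorem eq_rho {g : SUTilde} (h : g.z = 0) : g = rho g.arg := by
  ext1
  · exact h
  · rfl

theorem rho_injective : Function.Injective rho := fun _ _ h => congrArg SUTilde.arg h

theorem continuous_rho : Continuous rho :=
  continuous_mk.comp (Continuous.prodMk_right (0 : ℂ))

theorem exp_neg_mul_eq_iff {θ : ℝ} {z : ℂ} (hz : z ≠ 0) :
    Complex.exp (-(θ * Complex.I)) * z = Complex.exp (θ * Complex.I) * z ↔
      ∃ n : ℤ, n * Real.pi = θ := by
  rw [mul_left_inj' hz, ← Real.sin_eq_zero_iff]
  constructor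
  · intro h
    have h1 := congrArg Complex.im h
    rw [← neg_mul, ← Complex.ofReal_neg, Complex.exp_ofReal_mul_I_im, Complex.exp_ofReal_mul_I_im,
      Real.sin_neg] at h1
    linarith
  · intro h
    rw [← neg_mul, Complex.exp_mul_I, Complex.exp_mul_I, Complex.cos_neg, Complex.sin_neg,
      ← Complex.ofReal_sin, h]
    simp

theorem rho_mem_center_iff {θ : ℝ} :
    rho θ ∈ Subgroup.center SUTilde ↔ ∃ n : ℤ, n * Real.pi = θ := by
  rw [Subgroup.mem_center_iff]
  constructor
  · intro h
    have h1 := congrArg SUTilde.z (h ⟨1, 0⟩)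
    rw [rho_mul_z, mul_rho_z] at h1
    exact (exp_neg_mul_eq_iff (z := 1) one_ne_zero).1 h1.symm
  · intro h g
    ext1
    · rw [rho_mul_z, mul_rho_z]
      by_cases hz : g.z = 0
      · rw [hz, mul_zero, mul_zero]
      · exact ((exp_neg_mul_eq_iff hz).2 h).symm
    · rw [rho_mul_arg, mul_rho_arg, add_comm]

/-- Multiplication by the rotation on the left and on the right turns z by opposite angles; these
agree on a non-zero z only for central rotations. -/
theorem z_eq_zero_of_commute {θ : ℝ} {g : SUTilde} (h : Commute g (rho θ))
    (hθ : rho θ ∉ Subgroup.center SUTilde) : g.z = 0 := by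
  by_contra hz
  have h1 := congrArg SUTilde.z h.eq
  rw [rho_mul_z, mul_rho_z] at h1
  exact hθ (rho_mem_center_iff.2 ((exp_neg_mul_eq_iff hz).1 h1.symm))

theorem mem_center_iff {g : SUTilde} :
    g ∈ Subgroup.center SUTilde ↔ ∃ n : ℤ, g = rho (n * Real.pi) := by
  constructor
  · intro h
    have hz : g.z = 0 := by
      refine z_eq_zero_of_commute (θ := Real.pi / 2)
        (Subgroup.mem_center_iff.1 h _).symm fun hc => ?_
      obtain ⟨n, hn⟩ := rho_mem_center_iff.1 hc
      have h1 := congrArg Real.sin hn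
      rw [Real.sin_int_mul_pi, Real.sin_pi_div_two] at h1
      exact zero_ne_one h1
    have h' := h
    rw [eq_rho hz] at h'
    obtain ⟨n, hn⟩ := rho_mem_center_iff.1 h'
    exact ⟨n, by rw [hn]; exact eq_rho hz⟩
  · rintro ⟨n, rfl⟩
    exact rho_mem_center_iff.2 ⟨n, rfl⟩

/-- The lifts of the rotations of the disc around the point `b • 0`. -/
def rotAt (b : SUTilde) (θ : ℝ) : SUTilde := b * rho θ * b⁻¹

theorem rotAt_add (b : SUTilde) (θ η : ℝ) : rotAt b (θ + η) = rotAt b θ * rotAt b η := by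
  rw [rotAt, rotAt, rotAt, rho_add]; group

theorem rotAt_zero (b : SUTilde) : rotAt b 0 = 1 := by rw [rotAt, rho_zero]; group

theorem continuous_rotAt (b : SUTilde) : Continuous (rotAt b) :=
  (continuous_const.mul continuous_rho).mul continuous_const

theorem rotAt_injective (b : SUTilde) : Function.Injective (rotAt b) := fun θ η h =>
  rho_injective (by simpa [rotAt] using h)

theorem rotAt_mem_center_iff {b : SUTilde} {θ : ℝ} :
    rotAt b θ ∈ Subgroup.center SUTilde ↔ ∃ n : ℤ, n * Real.pi = θ := by
  rw [← rho_mem_center_iff, rotAt]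
  constructor
  · intro h
    have := (inferInstance : (Subgroup.center SUTilde).Normal).conj_mem _ h b⁻¹
    simpa [mul_assoc] using this
  · intro h
    exact (inferInstance : (Subgroup.center SUTilde).Normal).conj_mem _ h b

theorem rotAt_int_mul_pi (b : SUTilde) (n : ℤ) : rotAt b (n * Real.pi) = rho (n * Real.pi) := by
  have h := Subgroup.mem_center_iff.1 (rho_mem_center_iff.2 ⟨n, rfl⟩) b
  rw [rotAt, h]; group

/-- The one-parameter group of lifts of the rotations around `b • 0`. -/
def rotHom (b : SUTilde) : ℝ →+ Additive SUTilde where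
  toFun θ := Additive.ofMul (rotAt b θ)
  map_zero' := rotAt_zero b
  map_add' := rotAt_add b

theorem smul_zero_iff {g : SUTilde} : g • (0 : Complex.UnitDisc) = 0 ↔ g.z = 0 := by
  have h : ((g • (0 : Complex.UnitDisc) : Complex.UnitDisc) : ℂ) = g.z / g.w := by
    change (conj g.w * ((0 : Complex.UnitDisc) : ℂ) + g.z) /
      (conj g.z * ((0 : Complex.UnitDisc) : ℂ) + g.w) = _
    simp
  rw [← Complex.UnitDisc.coe_eq_zero, h, div_eq_zero_iff, or_iff_left g.w_ne_zero]

theorem exists_smul_zero_eq (u : Complex.UnitDisc) :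
    ∃ b : SUTilde, b • (0 : Complex.UnitDisc) = u := by
  have hu : 0 < 1 - ‖(u : ℂ)‖ ^ 2 := by linarith [u.sq_norm_lt_one]
  set s := Real.sqrt (1 - ‖(u : ℂ)‖ ^ 2) with hs
  have hs0 : 0 < s := Real.sqrt_pos.2 hu
  have hs2 : s ^ 2 = 1 - ‖(u : ℂ)‖ ^ 2 := Real.sq_sqrt hu.le
  refine ⟨⟨u / s, 0⟩, Complex.UnitDisc.coe_injective ?_⟩
  have hr : (⟨u / s, 0⟩ : SUTilde).r = 1 / s := by
    rw [r, Real.sqrt_eq_iff_mul_self_eq (by positivity) (by positivity), norm_div,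
      Complex.norm_real, Real.norm_eq_abs, abs_of_pos hs0]
    field_simp
    linarith
  have hsc : (s : ℂ) ≠ 0 := by exact_mod_cast hs0.ne'
  have hw : (⟨u / s, 0⟩ : SUTilde).w = 1 / s := by rw [w, hr]; simp
  change (conj (⟨u / s, 0⟩ : SUTilde).w * ((0 : Complex.UnitDisc) : ℂ) + u / s) /
      (conj (u / s : ℂ) * ((0 : Complex.UnitDisc) : ℂ) + (⟨u / s, 0⟩ : SUTilde).w) = u
  rw [hw]
  simp
  field_simp

theorem smul_eq_iff_exists_rotAt {b : SUTilde} {u : Complex.UnitDisc}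
    (hb : b • (0 : Complex.UnitDisc) = u) {g : SUTilde} :
    g • u = u ↔ ∃ θ, g = rotAt b θ := by
  have h1 : g • u = u ↔ (b⁻¹ * g * b) • (0 : Complex.UnitDisc) = 0 := by
    rw [← hb, mul_smul, mul_smul, inv_smul_eq_iff]
  rw [h1, smul_zero_iff]
  constructor
  · intro h
    refine ⟨(b⁻¹ * g * b).arg, ?_⟩
    rw [rotAt, ← eq_rho h]; group
  · rintro ⟨θ, rfl⟩
    have : b⁻¹ * rotAt b θ * b = rho θ := by rw [rotAt]; group
    rw [this]; rfl

/-- The angles of the rotations around `b • 0` belonging to `Γ`. -/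
def angles (Γ : Subgroup SUTilde) (b : SUTilde) : AddSubgroup ℝ :=
  (Subgroup.toAddSubgroup Γ).comap (rotHom b)

theorem mem_angles {Γ : Subgroup SUTilde} {b : SUTilde} {θ : ℝ} :
    θ ∈ angles Γ b ↔ rotAt b θ ∈ Γ := Iff.rfl

/-- The map n ↦ `rotAt b (n * π)` has the centre as its range, so the preimage of Γ is the subgroup
of ℤ of index k. -/
theorem int_mul_pi_mem_angles_iff {Γ : Subgroup SUTilde} {k : ℕ}
    (hk : Γ.relIndex (Subgroup.center SUTilde) = k) (b : SUTilde) (n : ℤ) :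
    n * Real.pi ∈ angles Γ b ↔ (k : ℤ) ∣ n := by
  let f : ℤ →+ Additive SUTilde := (rotHom b).comp (zmultiplesHom ℝ Real.pi)
  have hf : ∀ n : ℤ, f n = Additive.ofMul (rotAt b (n * Real.pi)) := fun n => by
    simp only [f, AddMonoidHom.comp_apply, zmultiplesHom_apply, zsmul_eq_mul]
    rfl
  have hr : f.range = Subgroup.toAddSubgroup (Subgroup.center SUTilde) := by
    ext x
    constructor
    · rintro ⟨n, rfl⟩
      rw [hf]
      exact rotAt_mem_center_iff.2 ⟨n, rfl⟩
    · intro hx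
      obtain ⟨n, hn⟩ := mem_center_iff.1 (show x.toMul ∈ Subgroup.center SUTilde from hx)
      exact ⟨n, by rw [hf, rotAt_int_mul_pi, ← hn]; rfl⟩
  have hindex : ((Subgroup.toAddSubgroup Γ).comap f).index = k := by
    rw [AddSubgroup.index_comap, hr, Subgroup.relIndex_toAddSubgroup, hk]
  obtain ⟨a, ha⟩ := (AddSubgroup.isAddCyclic_iff_exists_zmultiples_eq_top
    (H := (Subgroup.toAddSubgroup Γ).comap f)).1 inferInstance
  have hmem : n * Real.pi ∈ angles Γ b ↔ n ∈ (Subgroup.toAddSubgroup Γ).comap f := by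
    rw [AddSubgroup.mem_comap, hf]; rfl
  rw [← ha, Int.index_zmultiples] at hindex
  rw [hmem, ← ha, Int.mem_zmultiples_iff, ← hindex, Int.natAbs_dvd]

/-- A discrete group of angles is generated by some a, whose order modulo πℤ is the isotropy order
p. Since the multiples of π in Γ are those of kπ, pa is an integral multiple of kπ; conversely kπ is
an integral multiple of pa. So pa = ±kπ. -/
theorem angles_eq_zmultiples {Γ : Subgroup SUTilde} [DiscreteTopology Γ] {k : ℕ} (hk0 : 0 < k)
    (hk : Γ.relIndex (Subgroup.center SUTilde) = k) {b : SUTilde} {u : Complex.UnitDisc}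
    (hb : b • (0 : Complex.UnitDisc) = u) (hp : isotropyOrder Γ u ≠ 0) :
    angles Γ b = AddSubgroup.zmultiples (k * Real.pi / isotropyOrder Γ u) := by
  have hdisc : DiscreteTopology (angles Γ b) := by
    let f : angles Γ b → Γ := fun θ => ⟨rotAt b θ, θ.2⟩
    refine DiscreteTopology.of_continuous_injective (f := f)
      (((continuous_rotAt b).comp continuous_subtype_val).subtype_mk _) fun θ η h => ?_
    exact Subtype.ext (rotAt_injective b (congrArg Subtype.val h))
  obtain ⟨a, ha⟩ := (AddSubgroup.isAddCyclic_iff_exists_zmultiples_eq_top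
    (H := angles Γ b)).1 (AddSubgroup.discrete_iff_addCyclic.2 hdisc)
  have hzp : ∀ j : ℤ, rotAt b a ^ j = rotAt b (j * a) := fun j => by
    have := (map_zsmul (rotHom b) j a).symm
    rw [zsmul_eq_mul] at this
    exact this
  set x : SUTilde ⧸ Subgroup.center SUTilde := QuotientGroup.mk' _ (rotAt b a) with hx
  have himg : (Γ ⊓ MulAction.stabilizer SUTilde u).map
      (QuotientGroup.mk' (Subgroup.center SUTilde)) = Subgroup.zpowers x := by
    have h1 : Γ ⊓ MulAction.stabilizer SUTilde u = Subgroup.zpowers (rotAt b a) := by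
      ext g
      rw [Subgroup.mem_inf, MulAction.mem_stabilizer_iff, smul_eq_iff_exists_rotAt hb,
        Subgroup.mem_zpowers_iff]
      constructor
      · rintro ⟨hg, θ, rfl⟩
        have h2 : θ ∈ angles Γ b := hg
        rw [← ha] at h2
        obtain ⟨j, rfl⟩ := AddSubgroup.mem_zmultiples_iff.1 h2
        exact ⟨j, by rw [hzp, zsmul_eq_mul]⟩
      · rintro ⟨j, rfl⟩
        refine ⟨Γ.zpow_mem ?_ j, j * a, hzp j⟩
        rw [← mem_angles, ← ha]
        exact AddSubgroup.mem_zmultiples a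
    rw [h1, MonoidHom.map_zpowers]
  have hcard : isotropyOrder Γ u = orderOf x := by
    rw [isotropyOrder, himg, Nat.card_zpowers]
  set p := isotropyOrder Γ u with hpd
  have hxj : ∀ j : ℤ, (p : ℤ) ∣ j ↔ ∃ n : ℤ, n * Real.pi = j * a := fun j => by
    rw [hcard, orderOf_dvd_iff_zpow_eq_one, hx, ← map_zpow, hzp, QuotientGroup.mk'_apply,
      QuotientGroup.eq_one_iff, rotAt_mem_center_iff]
  have hmemj : ∀ j : ℤ, (j : ℝ) * a ∈ angles Γ b := fun j => by
    rw [← ha, ← zsmul_eq_mul]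
    exact AddSubgroup.zsmul_mem_zmultiples a j
  obtain ⟨n, hn⟩ := (hxj p).1 dvd_rfl
  obtain ⟨m, rfl⟩ := (int_mul_pi_mem_angles_iff hk b n).1 (hn ▸ hmemj p)
  have hkmem : (k : ℤ) * Real.pi ∈ angles Γ b :=
    (int_mul_pi_mem_angles_iff hk b k).2 dvd_rfl
  rw [← ha] at hkmem
  obtain ⟨j, hj⟩ := AddSubgroup.mem_zmultiples_iff.1 hkmem
  rw [zsmul_eq_mul] at hj
  obtain ⟨l, rfl⟩ := (hxj j).2 ⟨k, hj.symm⟩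
  push_cast at hj hn
  have hkpi : (k : ℝ) * Real.pi ≠ 0 := by
    have := Real.pi_pos
    have : (0 : ℝ) < k := by exact_mod_cast hk0
    positivity
  have hlm : l * m = 1 := by
    have h1 : (l : ℝ) * m * (k * Real.pi) = 1 * (k * Real.pi) := by linear_combination l * hn + hj
    exact_mod_cast mul_right_cancel₀ hkpi h1
  have hp' : (p : ℝ) ≠ 0 := by exact_mod_cast hp
  rw [← ha]
  rcases Int.eq_one_or_neg_one_of_mul_eq_one hlm with rfl | rfl
  · congr 1
    rw [eq_div_iff hp', ← hj]; push_cast; ring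
  · have : a = -(k * Real.pi / p) := by
      rw [← neg_div, eq_div_iff hp', ← hj]; push_cast; ring
    rw [this, AddSubgroup.zmultiples_neg]

/-- Bézout's identity divided by pq, using gcd · lcm = pq. -/
theorem zmultiples_div_sup_zmultiples_div (c : ℝ) {p q : ℕ} (hp : p ≠ 0) (hq : q ≠ 0) :
    AddSubgroup.zmultiples (c / p) ⊔ AddSubgroup.zmultiples (c / q)
      = AddSubgroup.zmultiples (c / Nat.lcm p q) := by
  have hp' : (p : ℝ) ≠ 0 := by exact_mod_cast hp
  have hq' : (q : ℝ) ≠ 0 := by exact_mod_cast hq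
  have hl' : (Nat.lcm p q : ℝ) ≠ 0 := by exact_mod_cast Nat.lcm_ne_zero hp hq
  apply le_antisymm
  · rw [sup_le_iff, AddSubgroup.zmultiples_le, AddSubgroup.zmultiples_le]
    constructor
    · obtain ⟨d, hd⟩ := Nat.dvd_lcm_left p q
      rw [hd] at hl' ⊢
      push_cast at hl' ⊢
      refine AddSubgroup.mem_zmultiples_iff.2 ⟨d, ?_⟩
      have := right_ne_zero_of_mul hl'
      rw [zsmul_eq_mul]; push_cast; field_simp
    · obtain ⟨d, hd⟩ := Nat.dvd_lcm_right p q
      rw [hd] at hl' ⊢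
      push_cast at hl' ⊢
      refine AddSubgroup.mem_zmultiples_iff.2 ⟨d, ?_⟩
      have := right_ne_zero_of_mul hl'
      rw [zsmul_eq_mul]; push_cast; field_simp
  · rw [AddSubgroup.zmultiples_le]
    refine AddSubgroup.mem_sup.2 ⟨(Nat.gcdB p q) • (c / p), AddSubgroup.zsmul_mem_zmultiples _ _,
      (Nat.gcdA p q) • (c / q), AddSubgroup.zsmul_mem_zmultiples _ _, ?_⟩
    have h1 : (Nat.gcd p q : ℝ) = p * Nat.gcdA p q + q * Nat.gcdB p q := by
      exact_mod_cast Nat.gcd_eq_gcd_ab p q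
    have h2 : (Nat.gcd p q : ℝ) * Nat.lcm p q = p * q := by
      exact_mod_cast Nat.gcd_mul_lcm p q
    rw [zsmul_eq_mul, zsmul_eq_mul]
    field_simp
    rw [h1] at h2
    linear_combination c * h2

end SUTilde

open SUTilde in
/-- The isotropy groups of `u` in `Γ₁` and `Γ₂` generate the group of rotations around `u` through
the multiples of an angle less than `π`. -/
theorem Admissible.exists_angle {Γ₁ Γ₂ : Subgroup SUTilde} {k : ℕ} {u : Complex.UnitDisc}
    (hΓ : Admissible Γ₁ Γ₂ k u) {b : SUTilde} (hb : b • (0 : Complex.UnitDisc) = u) :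
    ∃ ϑ : ℝ, 0 < ϑ ∧ ϑ < Real.pi ∧
      angles Γ₁ b ⊔ angles Γ₂ b = AddSubgroup.zmultiples ϑ := by
  have := hΓ.discrete₁
  have := hΓ.discrete₂
  have hl : Nat.lcm (isotropyOrder Γ₁ u) (isotropyOrder Γ₂ u) ≠ 0 :=
    (hΓ.level_pos.trans hΓ.level_lt).ne'
  have hp : isotropyOrder Γ₁ u ≠ 0 := fun h => hl (by rw [h, Nat.lcm_zero_left])
  have hq : isotropyOrder Γ₂ u ≠ 0 := fun h => hl (by rw [h, Nat.lcm_zero_right])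
  have hk : (0 : ℝ) < k := by exact_mod_cast hΓ.level_pos
  have hkl : (k : ℝ) < Nat.lcm (isotropyOrder Γ₁ u) (isotropyOrder Γ₂ u) := by
    exact_mod_cast hΓ.level_lt
  have hπ := Real.pi_pos
  refine ⟨k * Real.pi / Nat.lcm (isotropyOrder Γ₁ u) (isotropyOrder Γ₂ u), ?_, ?_, ?_⟩
  · exact div_pos (mul_pos hk hπ) (hk.trans hkl)
  · rw [div_lt_iff₀ (hk.trans hkl), mul_comm]
    exact mul_lt_mul_of_pos_left hkl hπ
  · rw [angles_eq_zmultiples hΓ.level_pos hΓ.level₁ hb hp,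
      angles_eq_zmultiples hΓ.level_pos hΓ.level₂ hb hq,
      zmultiples_div_sup_zmultiples_div _ hp hq]

open SUTilde in
/-- The cyclic group `Γ₂` consists of rotations around `u`. -/
theorem Admissible.exists_rotAt {Γ₁ Γ₂ : Subgroup SUTilde} {k : ℕ} {u : Complex.UnitDisc}
    (hΓ : Admissible Γ₁ Γ₂ k u) {b : SUTilde} (hb : b • (0 : Complex.UnitDisc) = u)
    {g : SUTilde} (hg : g ∈ Γ₂) : ∃ θ, g = rotAt b θ := by
  obtain ⟨h, hh, hhc, hhu⟩ := hΓ.fixed₂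
  obtain ⟨θ, rfl⟩ := (smul_eq_iff_exists_rotAt hb).1 hhu
  have := hΓ.cyclic₂
  -- Commuting with a non-central rotation around u forces g to be a rotation around u as well.
  have hcomm : g * rotAt b θ = rotAt b θ * g := by
    have h1 : (⟨g, hg⟩ : Γ₂) * ⟨_, hh⟩ = ⟨_, hh⟩ * ⟨g, hg⟩ := by
      obtain ⟨c, hc⟩ := IsCyclic.exists_generator (α := Γ₂)
      obtain ⟨i, hi⟩ := Subgroup.mem_zpowers_iff.1 (hc ⟨g, hg⟩)
      obtain ⟨j, hj⟩ := Subgroup.mem_zpowers_iff.1 (hc ⟨_, hh⟩)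
      rw [← hi, ← hj, ← zpow_add, ← zpow_add, add_comm]
    exact congrArg Subtype.val h1
  have hz : (b⁻¹ * g * b).z = 0 := by
    refine z_eq_zero_of_commute (θ := θ) ?_ fun hc => hhc ?_
    · have e : b⁻¹ * (g * rotAt b θ) * b = b⁻¹ * (rotAt b θ * g) * b := by rw [hcomm]
      change b⁻¹ * g * b * rho θ = rho θ * (b⁻¹ * g * b)
      rw [rotAt] at e
      calc b⁻¹ * g * b * rho θ = b⁻¹ * (g * (b * rho θ * b⁻¹)) * b := by group
        _ = _ := e
        _ = _ := by group
    · exact rotAt_mem_center_iff.2 (rho_mem_center_iff.1 hc)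
  exact ⟨(b⁻¹ * g * b).arg, by rw [rotAt, ← eq_rho hz]; group⟩

namespace SUTilde

theorem mul_rho_r (θ : ℝ) (g : SUTilde) : (g * rho θ).r = g.r := by
  rw [r, mul_rho_z, norm_mul, r, Complex.norm_exp_ofReal_mul_I, one_mul]

theorem r_conj_le (b g : SUTilde) : (b * g * b⁻¹).r ≤ 4 * b.r ^ 2 * g.r := by
  refine (r_mul_le _ _).trans ?_
  rw [r_inv]
  have h1 := mul_le_mul_of_nonneg_right (r_mul_le b g) b.r_pos.le
  linarith

theorem r_conj_inv_le (b g : SUTilde) : (b⁻¹ * g * b).r ≤ 4 * b.r ^ 2 * g.r := by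
  have h := r_conj_le b⁻¹ g
  rwa [inv_inv, r_inv] at h

theorem abs_arg_mul_le (g h : SUTilde) : |(g * h).arg| ≤ |g.arg| + |h.arg| + Real.pi / 2 := by
  have h1 := abs_mul_arg_sub_lt g h
  have h2 := abs_sub_abs_le_abs_sub (g * h).arg (g.arg + h.arg)
  have h3 := abs_add_le g.arg h.arg
  linarith

/-! ### Cosets of rotations and local finiteness -/

/-- The elements `a • ρ` for the rotations `ρ` around `b • 0` through multiples of `ϑ`. -/
def rotCoset (b : SUTilde) (ϑ : ℝ) (a : SUTilde) : Set SUTilde :=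
  range fun m : ℤ => a * rotAt b (m * ϑ)

theorem rotCoset_eq_of_mem {b : SUTilde} {ϑ : ℝ} {a g : SUTilde} (hg : g ∈ rotCoset b ϑ a) :
    rotCoset b ϑ a = rotCoset b ϑ g := by
  obtain ⟨m, rfl⟩ := hg
  ext x
  constructor
  · rintro ⟨j, rfl⟩
    refine ⟨j - m, ?_⟩
    simp only
    rw [mul_assoc, ← rotAt_add]
    push_cast
    congr 2; ring
  · rintro ⟨j, rfl⟩
    refine ⟨m + j, ?_⟩
    simp only
    rw [mul_assoc, ← rotAt_add]
    push_cast
    congr 2; ring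

theorem finite_setOf_mem_of_bounded (Γ : Subgroup SUTilde) [DiscreteTopology Γ] (C D : ℝ) :
    {g : SUTilde | g ∈ Γ ∧ g.r ≤ C ∧ |g.arg| ≤ D}.Finite := by
  have hcl : IsClosed (Γ : Set SUTilde) := Subgroup.isClosed_of_discrete
  have hK : IsCompact ((Γ : Set SUTilde) ∩ {g | g.r ≤ C ∧ |g.arg| ≤ D}) :=
    (isCompact_bounded C D).inter_left hcl
  refine hK.finite ?_
  have hd : IsDiscrete (Γ : Set SUTilde) := ⟨‹_›⟩
  exact hd.mono inter_subset_left

end SUTilde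

namespace LTilde

open SUTilde

/-- Conjugation invariance of κ replaces the rotation around b • 0 by one around 0, which shifts the
argument and preserves r. All heights along a coset are therefore shifts of one profile. -/
theorem height_mul_rotAt (a b : SUTilde) (θ : ℝ) (q : LTilde) :
    height (a * rotAt b θ) q
      = q.t * ((b⁻¹ * (a⁻¹ * q.h) * b).r * cosCut ((b⁻¹ * (a⁻¹ * q.h) * b).arg - θ)) := by
  have h1 : (a * rotAt b θ)⁻¹ * q.h = b * (rho (-θ) * (b⁻¹ * (a⁻¹ * q.h))) := by
    rw [rotAt, rho_neg]; group
  rw [height, h1, kappa_mul_comm, mul_assoc, kappa, rho_mul_r, rho_mul_arg,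
    neg_add_eq_sub]

theorem height_mul_rotAt_le (a b : SUTilde) (θ : ℝ) (q : LTilde) :
    height (a * rotAt b θ) q ≤ q.t * (b⁻¹ * (a⁻¹ * q.h) * b).r := by
  rw [height_mul_rotAt]
  exact mul_le_mul_of_nonneg_left
    (mul_le_of_le_one_right (r_pos _).le (cosCut_le_one _)) q.t_pos.le

/-- The multiple of ϑ nearest to arg n is within ϑ/2, and ϑ < π makes the cosine there at least
cos(ϑ/2) > 0. A single element of the coset thus gives the bound. -/
theorem le_of_forall_height_le_one {a b : SUTilde} {ϑ : ℝ} (hϑ : 0 < ϑ) (hϑπ : ϑ < Real.pi)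
    {q : LTilde} (hq : ∀ g ∈ rotCoset b ϑ a, height g q ≤ 1) :
    q.t * (b⁻¹ * (a⁻¹ * q.h) * b).r ≤ 1 / Real.cos (ϑ / 2) := by
  set n := b⁻¹ * (a⁻¹ * q.h) * b with hn
  have hδ : 0 < Real.cos (ϑ / 2) :=
    Real.cos_pos_of_mem_Ioo ⟨by linarith [Real.pi_pos], by linarith⟩
  have h1 := hq _ ⟨round (n.arg / ϑ), rfl⟩
  simp only at h1
  rw [height_mul_rotAt, ← hn] at h1
  have h2 : |n.arg - round (n.arg / ϑ) * ϑ| ≤ ϑ / 2 := by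
    have e : n.arg - round (n.arg / ϑ) * ϑ = (n.arg / ϑ - round (n.arg / ϑ)) * ϑ := by
      field_simp
    rw [e, abs_mul, abs_of_pos hϑ]
    have := mul_le_mul_of_nonneg_right (abs_sub_round (n.arg / ϑ)) hϑ.le
    linarith
  have h3 : Real.cos (ϑ / 2) ≤ cosCut (n.arg - round (n.arg / ϑ) * ϑ) := by
    rw [cosCut_of_le (h2.trans (by linarith)), ← Real.cos_abs (n.arg - _)]
    exact Real.cos_le_cos_of_nonneg_of_le_pi (abs_nonneg _) (by linarith) h2
  rw [le_div_iff₀ hδ, mul_assoc]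
  exact (mul_le_mul_of_nonneg_left (mul_le_mul_of_nonneg_left h3 n.r_pos.le)
    q.t_pos.le).trans h1

theorem continuous_conj_h (a b : SUTilde) :
    Continuous fun q : LTilde => b⁻¹ * (a⁻¹ * q.h) * b :=
  (continuous_const.mul (continuous_const.mul continuous_h)).mul continuous_const

/-- A coset satisfied somewhere near q₀ has a representative in Γ with bounded r, by
`le_of_forall_height_le_one`, and bounded argument, after a shift by some `rho (j * c)`.
Discreteness leaves finitely many such cosets, and in each the cut-off kills all but finitely many
heights on N. -/
theorem locFin_rotCoset {Γ : Subgroup SUTilde} [DiscreteTopology Γ] {b : SUTilde} {ϑ : ℝ}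
    (hϑ : 0 < ϑ) (hϑπ : ϑ < Real.pi) {c : ℝ} (hc : 0 < c) (hcΓ : ∀ j : ℤ, rho (j * c) ∈ Γ)
    (hcϑ : ∀ j : ℤ, rho (j * c) ∈ rotCoset b ϑ 1) :
    LocFin (rotCoset b ϑ '' Γ) := by
  intro q₀
  have hδ : 0 < Real.cos (ϑ / 2) :=
    Real.cos_pos_of_mem_Ioo ⟨by linarith [Real.pi_pos], by linarith⟩
  set t₀ := q₀.t / 2 with ht₀
  have ht₀p : 0 < t₀ := half_pos q₀.t_pos
  set N : Set LTilde := {q | t₀ < q.t ∧ q.h.r < q₀.h.r + 1 ∧ |q.h.arg| < |q₀.h.arg| + 1} with hN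
  have hNn : N ∈ 𝓝 q₀ := by
    have e1 := continuous_t.continuousAt.eventually_const_lt (half_lt_self q₀.t_pos)
    have e2 := (SUTilde.continuous_r.comp continuous_h).continuousAt.eventually_lt_const
      (lt_add_one (q₀.h.r))
    have e3 := (SUTilde.continuous_arg.comp continuous_h).abs.continuousAt.eventually_lt_const
      (lt_add_one |q₀.h.arg|)
    exact e1.and (e2.and e3)
  -- This bounds r of a' = h (b n b⁻¹)⁻¹ through `r_mul_le`, `r_conj_le` and the bound on r(n).
  set C := 2 * (q₀.h.r + 1) * (4 * b.r ^ 2 * (1 / Real.cos (ϑ / 2) / t₀)) with hC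
  set X : Set SUTilde := {g | g ∈ Γ ∧ g.r ≤ C ∧ |g.arg| ≤ c} with hX
  have hXf : X.Finite := finite_setOf_mem_of_bounded Γ C c
  -- Three products in n = b⁻¹(a'⁻¹h)b cost π/2 each, and a fourth π/2 places arg n − mϑ beyond the
  -- cut-off.
  set D := 2 * |b.arg| + c + (|q₀.h.arg| + 1) + 2 * Real.pi with hD
  have hmf : {m : ℤ | |(m : ℝ) * ϑ| ≤ D}.Finite := by
    refine (finite_Icc (-⌈D / ϑ⌉) ⌈D / ϑ⌉).subset fun m (hm : |(m : ℝ) * ϑ| ≤ D) => ?_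
    rw [abs_mul, abs_of_pos hϑ, ← le_div_iff₀ hϑ] at hm
    have h1 : |(m : ℝ)| ≤ ⌈D / ϑ⌉ := hm.trans (Int.le_ceil _)
    have h2 : |m| ≤ ⌈D / ϑ⌉ := by exact_mod_cast h1
    exact abs_le.1 h2
  refine ⟨N, hNn, (fun p : SUTilde × ℤ => p.1 * rotAt b (p.2 * ϑ)) ''
    (X ×ˢ {m : ℤ | |(m : ℝ) * ϑ| ≤ D}), (hXf.prod hmf).image _, ?_⟩
  rintro _ ⟨a, ha, rfl⟩ q hq hTq
  -- Multiplication by `rho (j * c)` stays in Γ and in the coset, and brings the argument into a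
  -- period.
  set j : ℤ := -round (a.arg / c) with hj
  set a' := a * rho (j * c) with ha'
  have hTa : rotCoset b ϑ a = rotCoset b ϑ a' := by
    obtain ⟨m, hm⟩ := hcϑ j
    refine rotCoset_eq_of_mem ⟨m, ?_⟩
    simp only [one_mul] at hm ⊢
    rw [hm]
  have harg : |a'.arg| ≤ c := by
    rw [ha', mul_rho_arg]
    have e : a.arg + j * c = (a.arg / c - round (a.arg / c)) * c := by
      rw [hj]; push_cast; field_simp; ring
    rw [e, abs_mul, abs_of_pos hc]
    have := mul_le_mul_of_nonneg_right (abs_sub_round (a.arg / c)) hc.le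
    linarith
  have hr : a'.r ≤ C := by
    have h1 := le_of_forall_height_le_one hϑ hϑπ (hTa ▸ hTq)
    set n := b⁻¹ * (a'⁻¹ * q.h) * b with hn
    have h2 : n.r ≤ 1 / Real.cos (ϑ / 2) / t₀ := by
      rw [le_div_iff₀ ht₀p, mul_comm]
      exact (mul_le_mul_of_nonneg_right hq.1.le n.r_pos.le).trans h1
    have h3 : a' = q.h * (b * n * b⁻¹)⁻¹ := by rw [hn]; group
    have h4 : (b * n * b⁻¹).r ≤ 4 * b.r ^ 2 * (1 / Real.cos (ϑ / 2) / t₀) :=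
      (r_conj_le b n).trans (mul_le_mul_of_nonneg_left h2 (by positivity))
    rw [h3]
    refine (r_mul_le _ _).trans ?_
    rw [r_inv]
    refine mul_le_mul ?_ h4 (r_pos _).le ?_
    · linarith [hq.2.1]
    · have := q₀.h.r_pos; positivity
  have ha'X : a' ∈ X := ⟨Γ.mul_mem ha (hcΓ j), hr, harg⟩
  rw [hTa]
  rintro _ ⟨m, rfl⟩ hg q' hq'
  have hm : D < |(m : ℝ) * ϑ| := by
    by_contra! hcon
    exact hg ⟨(a', m), ⟨ha'X, hcon⟩, rfl⟩
  simp only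
  rw [height_mul_rotAt]
  set n := b⁻¹ * (a'⁻¹ * q'.h) * b with hn
  have hna : |n.arg| ≤ D - Real.pi / 2 := by
    have h1 := abs_arg_mul_le (b⁻¹ * (a'⁻¹ * q'.h)) b
    have h2 := abs_arg_mul_le b⁻¹ (a'⁻¹ * q'.h)
    have h3 := abs_arg_mul_le a'⁻¹ q'.h
    rw [inv_arg, abs_neg] at h2 h3
    have h4 := hq'.2.2
    linarith
  have hcut : Real.pi / 2 ≤ |n.arg - m * ϑ| := by
    have := abs_sub_abs_le_abs_sub ((m : ℝ) * ϑ) n.arg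
    rw [abs_sub_comm] at this
    linarith
  rw [cosCut_of_ge hcut, mul_zero, mul_zero]
  exact one_pos

end LTilde

/-! ### Co-compactness and Theorem B -/

open SUTilde LTilde

/-- The products `g₁ g₂` of the elements of `T(a • u)`. -/
theorem image_setT {Γ₁ Γ₂ : Subgroup SUTilde} {k : ℕ} {u : Complex.UnitDisc}
    (hΓ : Admissible Γ₁ Γ₂ k u) {b : SUTilde} (hb : b • (0 : Complex.UnitDisc) = u) {ϑ : ℝ}
    (hϑ : angles Γ₁ b ⊔ angles Γ₂ b = AddSubgroup.zmultiples ϑ) {a : SUTilde} (ha : a ∈ Γ₁) :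
    (fun g : SUTilde × SUTilde => g.1 * g.2) '' setT Γ₁ Γ₂ u (a • u) = rotCoset b ϑ a := by
  ext x
  constructor
  · rintro ⟨⟨g₁, g₂⟩, ⟨h1, h2, h3⟩, rfl⟩
    simp only at h1 h2 h3 ⊢
    obtain ⟨θ₂, rfl⟩ := hΓ.exists_rotAt hb h2
    obtain ⟨θ₁, hθ₁⟩ := (smul_eq_iff_exists_rotAt (g := a⁻¹ * g₁) hb).1
      (by rw [mul_smul, h3, inv_smul_smul])
    have h4 : θ₁ ∈ angles Γ₁ b := by
      rw [mem_angles, ← hθ₁]; exact Γ₁.mul_mem (Γ₁.inv_mem ha) h1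
    have h5 : θ₁ + θ₂ ∈ AddSubgroup.zmultiples ϑ := by
      rw [← hϑ]; exact AddSubgroup.add_mem_sup h4 h2
    obtain ⟨m, hm⟩ := AddSubgroup.mem_zmultiples_iff.1 h5
    refine ⟨m, ?_⟩
    simp only
    rw [← zsmul_eq_mul, hm, rotAt_add, ← hθ₁]; group
  · rintro ⟨m, rfl⟩
    have h1 : m • ϑ ∈ angles Γ₁ b ⊔ angles Γ₂ b := by
      rw [hϑ]; exact AddSubgroup.zsmul_mem_zmultiples ϑ m
    obtain ⟨θ₁, h1, θ₂, h2, h3⟩ := AddSubgroup.mem_sup.1 h1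
    refine ⟨(a * rotAt b θ₁, rotAt b θ₂), ⟨Γ₁.mul_mem ha h1, h2, ?_⟩, ?_⟩
    · simp only
      rw [mul_smul, (smul_eq_iff_exists_rotAt hb).2 ⟨θ₁, rfl⟩]
    · simp only
      rw [← zsmul_eq_mul, ← h3, rotAt_add, mul_assoc]

theorem polyP_eq_polyOf {Γ₁ Γ₂ : Subgroup SUTilde} {k : ℕ} {u : Complex.UnitDisc}
    (hΓ : Admissible Γ₁ Γ₂ k u) {b : SUTilde} (hb : b • (0 : Complex.UnitDisc) = u) {ϑ : ℝ}
    (hϑ : angles Γ₁ b ⊔ angles Γ₂ b = AddSubgroup.zmultiples ϑ) :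
    polyP Γ₁ Γ₂ u = polyOf (rotCoset b ϑ '' Γ₁) := by
  have hQ : ∀ a ∈ Γ₁, ∀ q, q ∈ prismQ Γ₁ Γ₂ u (a • u) ↔
      ∀ g ∈ rotCoset b ϑ a, height g q ≤ 1 := by
    intro a ha q
    rw [← image_setT hΓ hb hϑ ha, prismQ, mem_iInter₂, forall_mem_image]
    simp only [halfH_eq, mem_ofPred_eq]
  ext q
  rw [polyP, mem_iUnion₂]
  constructor
  · rintro ⟨_, ⟨⟨a, ha⟩, rfl⟩, hq⟩
    exact ⟨_, mem_image_of_mem _ ha, (hQ a ha q).1 hq⟩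
  · rintro ⟨_, ⟨a, ha, rfl⟩, hq⟩
    exact ⟨a • u, ⟨⟨a, ha⟩, rfl⟩, (hQ a ha q).2 hq⟩

/-- A co-compact group has a fundamental set contained in a bounded set. -/
theorem IsCocompact.exists_bound {Γ₁ Γ₂ : Subgroup SUTilde} (h : IsCocompact Γ₁ Γ₂) :
    ∃ R : ℝ, ∀ x : SUTilde, ∃ a ∈ Γ₁, ∃ c ∈ Γ₂, (a * x * c⁻¹).r ≤ R := by
  let := biAction Γ₁ Γ₂
  let s := MulAction.orbitRel (Γ₁ × Γ₂) SUTilde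
  have hcomp : CompactSpace (Quotient s) := h
  -- The images of the sets r < n are open and exhaust the compact quotient, so one of them is
  -- everything.
  let V : ℕ → Set (Quotient s) := fun n =>
    {y | ∃ x : SUTilde, Quotient.mk s x = y ∧ x.r < n}
  have hV : ∀ n, IsOpen (V n) := by
    intro n
    rw [← isQuotientMap_quotient_mk'.isOpen_preimage]
    have e : Quotient.mk s ⁻¹' V n =
        ⋃ γ : Γ₁ × Γ₂, {x : SUTilde | ((γ.1 : SUTilde) * x * (γ.2 : SUTilde)⁻¹).r < n} := by
      ext x
      rw [mem_iUnion]
      constructor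
      · rintro ⟨x', hx', hr⟩
        obtain ⟨γ, hγ⟩ := Quotient.exact hx'
        refine ⟨γ, ?_⟩
        have hγ' : (γ.1 : SUTilde) * x * (γ.2 : SUTilde)⁻¹ = x' := hγ
        change ((γ.1 : SUTilde) * x * (γ.2 : SUTilde)⁻¹).r < n
        rwa [hγ']
      · rintro ⟨γ, hγ⟩
        exact ⟨_, Quotient.sound ⟨γ, rfl⟩, hγ⟩
    change IsOpen (Quotient.mk s ⁻¹' V n)
    rw [e]
    refine isOpen_iUnion fun γ => isOpen_lt (SUTilde.continuous_r.comp ?_) continuous_const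
    exact (continuous_const.mul continuous_id).mul continuous_const
  have hcov : (univ : Set (Quotient s)) ⊆ ⋃ n, V n := by
    intro y _
    obtain ⟨x, rfl⟩ := Quotient.exists_rep y
    obtain ⟨n, hn⟩ := exists_nat_gt x.r
    exact mem_iUnion.2 ⟨n, x, rfl, hn⟩
  obtain ⟨n, hn⟩ := isCompact_univ.elim_directed_cover V hV hcov
    (Monotone.directed_le fun m n hmn y hy => by
      obtain ⟨x, hx, hr⟩ := hy
      exact ⟨x, hx, hr.trans_le (by exact_mod_cast hmn)⟩)
  refine ⟨n, fun x => ?_⟩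
  obtain ⟨x', hx', hr⟩ := hn (mem_univ (Quotient.mk s x))
  obtain ⟨γ, hγ⟩ := Quotient.exact hx'
  refine ⟨γ.1, γ.1.2, γ.2, γ.2.2, ?_⟩
  have hγ' : (γ.1 : SUTilde) * x * (γ.2 : SUTilde)⁻¹ = x' := hγ
  rw [hγ']
  exact hr.le

/-- If the action is co-compact, the radial coordinate is bounded below on the boundary of `P`. -/
theorem exists_lt_t_of_mem_frontier {Γ₁ Γ₂ : Subgroup SUTilde} (hcc : IsCocompact Γ₁ Γ₂)
    {b : SUTilde} (hrot : ∀ g ∈ Γ₂, ∃ θ, g = rotAt b θ) (ϑ : ℝ) :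
    ∃ c > 0, ∀ q ∈ frontier (polyOf (rotCoset b ϑ '' Γ₁)), c ≤ q.t := by
  obtain ⟨R, hR⟩ := hcc.exists_bound
  have hR0 : 0 < R := by
    obtain ⟨a, _, c, _, h⟩ := hR 1
    exact (r_pos _).trans_le h
  have hb := b.r_pos
  have hRp : 0 < 4 * b.r ^ 2 * R := by positivity
  refine ⟨1 / (4 * b.r ^ 2 * R), by positivity, fun q hq => ?_⟩
  by_contra! hlt
  obtain ⟨a, ha, c, hc, hac⟩ := hR q.h
  obtain ⟨θ, rfl⟩ := hrot c hc
  -- The element of Γ₂ moving `q.h` into the bounded region is a rotation around b • 0; after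
  -- conjugation by b it is a right rotation around 0 and does not affect r.
  have hr : (b⁻¹ * (a⁻¹⁻¹ * q.h) * b).r ≤ 4 * b.r ^ 2 * R := by
    have e : b⁻¹ * (a⁻¹⁻¹ * q.h) * b = b⁻¹ * (a * q.h * (rotAt b θ)⁻¹) * b * rho θ := by
      rw [rotAt]; group
    rw [e, mul_rho_r]
    exact (r_conj_inv_le _ _).trans (mul_le_mul_of_nonneg_left hac (by positivity))
  have hq1 : q.t * (b⁻¹ * (a⁻¹⁻¹ * q.h) * b).r < 1 := by
    rw [lt_div_iff₀ hRp] at hlt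
    exact (mul_le_mul_of_nonneg_left hr q.t_pos.le).trans_lt hlt
  have hcont : Continuous fun q : LTilde => q.t * (b⁻¹ * (a⁻¹⁻¹ * q.h) * b).r :=
    continuous_t.mul (SUTilde.continuous_r.comp (continuous_conj_h _ _))
  -- The strict bound t r(n) < 1 persists near q and dominates every height in the coset of a⁻¹, so
  -- q would be interior to P.
  refine hq.2 (mem_interior_iff_mem_nhds.2 ?_)
  filter_upwards [hcont.continuousAt.eventually_lt_const hq1] with q' hq'
  refine ⟨_, mem_image_of_mem _ (Γ₁.inv_mem ha), ?_⟩
  rintro _ ⟨m, rfl⟩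
  exact (height_mul_rotAt_le _ _ _ _).trans hq'.le

/-- On the face all conditions of the one coset containing g hold by passing to the limit, so t r(n)
≤ 1/cos(ϑ/2). With t ≥ c this bounds r; with r ≥ 1 it bounds t; and height 1 over g bounds the
argument. -/
theorem isCompact_face {𝓕 : Set (Set SUTilde)} (h𝓕 : LocFin 𝓕) {b g : SUTilde} {ϑ : ℝ}
    (hϑ : 0 < ϑ) (hϑπ : ϑ < Real.pi) (hg : ∀ T ∈ 𝓕, g ∈ T → T = rotCoset b ϑ g) {c : ℝ}
    (hc : 0 < c) (hfr : ∀ q ∈ frontier (polyOf 𝓕), c ≤ q.t) :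
    IsCompact (closure (faceCore (polyOf 𝓕) g)) := by
  have hδ : 0 < Real.cos (ϑ / 2) :=
    Real.cos_pos_of_mem_Ioo ⟨by linarith [Real.pi_pos], by linarith⟩
  set δ := Real.cos (ϑ / 2)
  set K : Set (SUTilde × ℝ) :=
    {m : SUTilde | m.r ≤ 4 * b.r ^ 2 * (1 / δ / c) ∧ |m.arg| ≤ Real.pi / 2} ×ˢ Icc c (1 / δ)
    with hK
  have hKc : IsCompact K := (isCompact_bounded _ _).prod isCompact_Icc
  -- On K the second coordinate is at least c, so the maximum is inert there and only keeps the
  -- radius positive elsewhere.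
  let f : SUTilde × ℝ → LTilde := fun p =>
    scale (g * p.1) ⟨max p.2 c, mem_Ioi.2 (lt_max_of_lt_right hc)⟩
  have hf : Continuous f := continuous_scale.comp
    ((continuous_const.mul continuous_fst).prodMk
      (Continuous.subtype_mk (continuous_snd.max continuous_const) _))
  refine (hKc.image hf).of_isClosed_subset isClosed_closure fun q hq => ?_
  have h1 : height g q = 1 := by
    refine closure_minimal ?_ (isClosed_eq (continuous_height g) continuous_const) hq
    rintro q ⟨hq, V, hV, hVs⟩
    exact hVs ⟨mem_of_mem_nhds hV, hq⟩
  have h2 : c ≤ q.t :=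
    hfr q (closure_minimal (fun q hq => hq.1) isClosed_frontier hq)
  have h3 : ∀ h ∈ rotCoset b ϑ g, height h q ≤ 1 := by
    have hcl : IsClosed {q | ∀ h ∈ rotCoset b ϑ g, height h q ≤ 1} := by
      have e : {q | ∀ h ∈ rotCoset b ϑ g, height h q ≤ 1} =
          ⋂ h ∈ rotCoset b ϑ g, {q | height h q ≤ 1} := by ext q; simp
      rw [e]
      exact isClosed_biInter fun h _ => isClosed_le (continuous_height h) continuous_const
    refine closure_minimal ?_ hcl (exists_local_cells h𝓕 hq).1
    rintro q ⟨T, hT, hgT, hTq⟩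
    exact hg T hT hgT ▸ hTq
  have h4 := le_of_forall_height_le_one hϑ hϑπ h3
  set n := b⁻¹ * (g⁻¹ * q.h) * b with hn
  have h5 : n.r ≤ 1 / δ / c := by
    rw [le_div_iff₀ hc, mul_comm]
    exact (mul_le_mul_of_nonneg_right h2 n.r_pos.le).trans h4
  have h6 : q.t ≤ 1 / δ :=
    (le_mul_of_one_le_right q.t_pos.le n.one_le_r).trans h4
  have h7 : g⁻¹ * q.h = b * n * b⁻¹ := by rw [hn]; group
  refine ⟨(g⁻¹ * q.h, q.t), ⟨⟨?_, ?_⟩, h2, h6⟩, ?_⟩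
  · rw [h7]
    exact (r_conj_le b n).trans (mul_le_mul_of_nonneg_left h5 (by positivity))
  · exact (abs_arg_lt_of_height_pos (h1 ▸ zero_lt_one)).le
  · refine ext_polar ?_ ?_
    · simp only [f, scale_h, mul_inv_cancel_left]
    · simp only [f, scale_t, max_eq_left h2]

theorem isCompactPolyhedron_face {𝓕 : Set (Set SUTilde)} (h𝓕 : LocFin 𝓕) {g : SUTilde}
    (hF : IsCompact (closure (faceCore (polyOf 𝓕) g))) :
    IsCompactPolyhedron (closure (faceCore (polyOf 𝓕) g)) := by
  set F := closure (faceCore (polyOf 𝓕) g)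
  have key : ∃ 𝒞 : Set (Set LTilde), 𝒞.Finite ∧ (∀ C ∈ 𝒞, IsCompactCell C) ∧
      F ⊆ ⋃₀ 𝒞 ∧ ⋃₀ 𝒞 ⊆ F := by
    -- The cells are required to lie in F rather than in s, which makes the property pass to subsets
    -- and finite unions.
    refine hF.induction_on (p := fun s => ∃ 𝒞 : Set (Set LTilde), 𝒞.Finite ∧
      (∀ C ∈ 𝒞, IsCompactCell C) ∧ s ⊆ ⋃₀ 𝒞 ∧ ⋃₀ 𝒞 ⊆ F) ?_ ?_ ?_ ?_
    · exact ⟨∅, finite_empty, by simp, by simp, by simp⟩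
    · rintro s t hst ⟨𝒞, h1, h2, h3, h4⟩
      exact ⟨𝒞, h1, h2, hst.trans h3, h4⟩
    · rintro s t ⟨𝒞, h1, h2, h3, h4⟩ ⟨𝒟, k1, k2, k3, k4⟩
      refine ⟨𝒞 ∪ 𝒟, h1.union k1, fun C hC => hC.elim (h2 C) (k2 C), ?_, ?_⟩
      · rw [sUnion_union]; exact union_subset_union h3 k3
      · rw [sUnion_union]; exact union_subset h4 k4
    · intro q hq
      obtain ⟨M, hM, 𝒞, h1, h2, h3, h4⟩ := (exists_local_cells h𝓕 hq).2
      exact ⟨F ∩ M, inter_mem_nhdsWithin F hM, 𝒞, h1, h2, h3, h4⟩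
  obtain ⟨𝒞, h1, h2, h3, h4⟩ := key
  exact ⟨𝒞, h1, h3.antisymm h4, h2⟩

theorem theoremB (Γ₁ Γ₂ : Subgroup SUTilde) (k : ℕ) (u : Complex.UnitDisc)
    (hΓ : Admissible Γ₁ Γ₂ k u) (hcc : IsCocompact Γ₁ Γ₂)
    (g₁ g₂ : SUTilde) (hg₁ : g₁ ∈ Γ₁) (hg₂ : g₂ ∈ Γ₂) :
    IsCompact (domF Γ₁ Γ₂ u (g₁ * g₂)) ∧ IsCompactPolyhedron (domF Γ₁ Γ₂ u (g₁ * g₂)) := by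
  have := hΓ.discrete₁
  obtain ⟨b, hb⟩ := exists_smul_zero_eq u
  obtain ⟨ϑ, hϑ, hϑπ, hsup⟩ := hΓ.exists_angle hb
  -- The multiples of kπ are the angles of Γ₁ ∩ Z; they serve as the shifts c in `locFin_rotCoset`.
  have hkπ : (0 : ℝ) < k * Real.pi :=
    mul_pos (by exact_mod_cast hΓ.level_pos) Real.pi_pos
  have hang : ∀ j : ℤ, (j : ℝ) * (k * Real.pi) ∈ angles Γ₁ b ∧
      rotAt b (j * (k * Real.pi)) = rho (j * (k * Real.pi)) := fun j => by
    have e : (j : ℝ) * (k * Real.pi) = ((j * k : ℤ) : ℝ) * Real.pi := by push_cast; ring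
    rw [e]
    exact ⟨(int_mul_pi_mem_angles_iff hΓ.level₁ b _).2 (dvd_mul_left _ _),
      rotAt_int_mul_pi b _⟩
  have hlf : LocFin (rotCoset b ϑ '' Γ₁) := by
    refine locFin_rotCoset hϑ hϑπ hkπ (fun j => ?_) fun j => ?_
    · rw [← (hang j).2]; exact (hang j).1
    · have h1 : (j : ℝ) * (k * Real.pi) ∈ AddSubgroup.zmultiples ϑ := by
        rw [← hsup]; exact AddSubgroup.mem_sup_left (hang j).1
      obtain ⟨m, hm⟩ := AddSubgroup.mem_zmultiples_iff.1 h1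
      refine ⟨m, ?_⟩
      simp only [one_mul]
      rw [← zsmul_eq_mul, hm, (hang j).2]
  obtain ⟨c, hc, hfr⟩ := exists_lt_t_of_mem_frontier hcc
    (fun g hg => hΓ.exists_rotAt hb hg) ϑ (b := b)
  have hF : IsCompact (closure (faceCore (polyOf (rotCoset b ϑ '' Γ₁)) (g₁ * g₂))) := by
    refine isCompact_face (b := b) hlf hϑ hϑπ ?_ hc hfr
    rintro _ ⟨a, _, rfl⟩ hg
    exact rotCoset_eq_of_mem hg
  rw [domF, polyP_eq_polyOf hΓ hb hsup, image_closure_interior_eq]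
  exact ⟨hF, isCompactPolyhedron_face hlf hF⟩
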